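/- **Theorem 2 (Semi-bandits).** Let $N,d,T\ge 1$ and $K\ge 0$ be integers, and let $\mathcal A$ be a nonempty family of subsets of $[N]=\{1,\dots,N\}$, each of size at most $K$. Consider the combinatorial semi-bandit under the Gaussian linear mixed model. The item features $(\mathbf x_1,\dots,\mathbf x_N)\in(\mathbb R^d)^N$ are drawn from some joint law (possibly deterministic), are known to the agent, and satisfy $\|\mathbf x_i\|_2\le 1$ almost surely for all $i$. Independently of the features, $\boldsymbol\gamma\sim\mathcal N(\boldsymbol\mu_{\boldsymbol\gamma},\Sigma_{\boldsymbol\gamma})$ with $\Sigma_{\boldsymbol\gamma}$ positive semidefinite. Given these, the $\theta_i\sim\mathcal N(\mathbf x_i^{T}\boldsymbol\gamma,\sigma_1^2)$, $i\in[N]$, are independent. In round $t=1,\dots,T$ the agent chooses $A_t\in\mathcal A$ and observes, for every $i\in A_t$, an independent $Y_{i,t}\sim\mathcal N(\theta_i,\sigma_2^2)$; the reward is $R_t=\sum_{i\in A_t}Y_{i,t}$. Here $\sigma_1,\sigma_2>0$, and $\boldsymbol\mu_{\boldsymbol\gamma},\Sigma_{\boldsymbol\gamma},\sigma_1,\sigma_2$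 are known. Write $r(a,\boldsymbol\theta)=\mathbb E[R_t\mid A_t=a,\boldsymbol\theta]$ and $\mathcal H_t=(A_l,(Y_{i,l})_{i\in A_l})_{l<t}$. The algorithm MTSS does the following in every round $t$: it draws $\tilde{\boldsymbol\gamma}$ from the posterior $\mathbb P(\boldsymbol\gamma\mid\mathcal H_t)$, draws $\tilde{\boldsymbol\theta}$ from the posterior $\mathbb P(\boldsymbol\theta\mid\mathcal H_t,\tilde{\boldsymbol\gamma})$, and plays $A_t\in\arg\max_{a\in\mathcal A}r(a,\tilde{\boldsymbol\theta})$ (ties broken by any fixed measurable rule). Its Bayes regret is $BR(T)=\mathbb E\sum_{t=1}^T\big[\max_{a\in\mathcal A}r(a,\boldsymbol\theta)-r(A_t,\boldsymbol\theta)\big]$, the expectation being over the features, $\boldsymbol\gamma$, $\boldsymbol\theta$, the observations and the draws of the algorithm. Let $\lambda_1(\Sigma_{\boldsymbol\gamma})$ be the largest eigenvalue of $\Sigma_{\boldsymbol\gamma}$ and $$c_1=4\sqrt{\frac{\lambda_1(\Sigma_{\boldsymbol\gamma})+\sigma_1^2}{2\log\big(1+(\lambda_1(\Sigma_{\boldsymbol\gamma})+\sigma_1^2)/\sigma_2^2\big)}\,\log(4NT^2)}.$$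 Then $BR(T)\le B$, where $$B=c_1K\sqrt{Td}\,\sqrt{\log\Big(1+\frac{N\lambda_1(\Sigma_{\boldsymbol\gamma})}{\sigma_1^2+\sigma_2^2/T}\Big)}+c_1\sqrt{NTK}\,\sqrt{\log\Big(1+\frac{\sigma_1^2}{\sigma_2^2}T\Big)}+K\sqrt{\frac2N\big(\lambda_1(\Sigma_{\boldsymbol\gamma})+\sigma_1^2\big)}.$$ Moreover, as long as $\lambda_1(\Sigma_{\boldsymbol\gamma}),\sigma_1,\sigma_2$ stay bounded, $B=\tilde O\big(K\sqrt{Td}+\sqrt{NTK}\big)$: there is an integer $p\ge 0$ such that for every $M$ there is a constant $C$ with $B\le C\,(1+\log(NT))^p\,\big(K\sqrt{Td}+\sqrt{NTK}\big)$ for all $N,d,T\ge1$, all $K\ge 0$ and all parameters with $\lambda_1(\Sigma_{\boldsymbol\gamma}),\sigma_1,\sigma_2\le M$. -/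

import Mathlib

open MeasureTheory ProbabilityTheory
open scoped ENNReal NNReal

noncomputable section

namespace SemiBandit

/-- The feature space `ℝᵈ` with its Euclidean norm. -/
abbrev Feature (d : ℕ) : Type := EuclideanSpace ℝ (Fin d)

/-- The known parameters of the Gaussian linear mixed model: the meta parameter is
`γ ~ N(μ, S)`, the item parameters are `θ_i ~ N(x_iᵀ γ, σ₁²)`, and the observations are
`Y_{i,t} ~ N(θ_i, σ₂²)`. -/
structure Params (d : ℕ) where
  /-- prior mean of `γ` -/
  μ : Feature d
  /-- prior covariance matrix of `γ` -/
  S : Matrix (Fin d) (Fin d) ℝ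
  posSemidef : S.PosSemidef
  /-- standard deviation of an item parameter around its prediction -/
  σ₁ : ℝ≥0
  /-- standard deviation of an observation -/
  σ₂ : ℝ≥0
  σ₁_pos : 0 < σ₁
  σ₂_pos : 0 < σ₂

/-- The largest eigenvalue of a (symmetric) matrix. -/
def maxEigenvalue {d : ℕ} (S : Matrix (Fin d) (Fin d) ℝ) : ℝ := sSup (spectrum ℝ S)

/-- What is seen in one round: the chosen set `a` of items, and one observation for every item
of `a` (semi-bandit feedback). -/
abbrev Record (N : ℕ) : Type := Σ a : Finset (Fin N), (a → ℝ)

/-- A history of `t` rounds. -/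
abbrev Hist (N t : ℕ) : Type := Fin t → Record N

section Model

variable {N d : ℕ} (P : Params d)

/-- The prior law `N(μ, S)` of the meta parameter `γ`. -/
def metaPrior : Measure (Feature d) := multivariateGaussian P.μ P.S

/-- The generalization model: given `γ` the item parameters are independent with
`θ_i ~ N(x_iᵀ γ, σ₁²)`. -/
def itemPrior (x : Fin N → Feature d) (γ : Feature d) : Measure (Fin N → ℝ) :=
  Measure.pi fun i => gaussianReal (inner ℝ (x i) γ) (P.σ₁ ^ 2)

/-- The law of the observations when the set `a` is chosen: independent `Y_i ~ N(θ_i, σ₂²)` for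
`i ∈ a`. -/
def obsLaw (θ : Fin N → ℝ) (a : Finset (Fin N)) : Measure (a → ℝ) :=
  Measure.pi fun i => gaussianReal (θ i) (P.σ₂ ^ 2)

/-- The expected reward `r(a, θ)` of the action `a`; the reward is the sum of the observations. -/
def meanReward (θ : Fin N → ℝ) (a : Finset (Fin N)) : ℝ :=
  ∫ y, ∑ i, y i ∂(obsLaw P θ a)

/-- The regret `max_{a' ∈ 𝒜} r(a', θ) - r(a, θ)` of the action `a` in one round. -/
def gap (𝒜 : Finset (Finset (Fin N))) (h𝒜 : 𝒜.Nonempty) (θ : Fin N → ℝ)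
    (a : Finset (Fin N)) : ℝ :=
  𝒜.sup' h𝒜 (meanReward P θ) - meanReward P θ a

/-- A measurable way to choose a maximizer of `r(·, θ)` over the feasible set `𝒜`, that is, an
exact optimization oracle together with its rule for breaking ties. -/
structure GreedyRule (𝒜 : Finset (Finset (Fin N))) where
  choice : (Fin N → ℝ) → Finset (Fin N)
  mem : ∀ θ, choice θ ∈ 𝒜
  maximal : ∀ θ, ∀ a ∈ 𝒜, meanReward P θ a ≤ meanReward P θ (choice θ)
  measurableSet : ∀ a, MeasurableSet {θ | choice θ = a}

/-- The likelihood of the item parameters `θ` given a history: the product of the densities of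
`N(θ_i, σ₂²)` at all the observations made. -/
def likelihood {t : ℕ} (h : Hist N t) (θ : Fin N → ℝ) : ℝ≥0∞ :=
  ∏ l, ∏ i : (h l).1, gaussianPDF (θ i) (P.σ₂ ^ 2) ((h l).2 i)

/-- Bayes' rule: the posterior law for the prior `π` and the likelihood function `L`. -/
def bayes {α : Type*} [MeasurableSpace α] (π : Measure α) (L : α → ℝ≥0∞) : Measure α :=
  (∫⁻ z, L z ∂π)⁻¹ • π.withDensity L

/-- The posterior law of `γ` given a history. -/
def metaPosterior (x : Fin N → Feature d) {t : ℕ} (h : Hist N t) : Measure (Feature d) :=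
  bayes (metaPrior P) fun γ => ∫⁻ θ, likelihood P h θ ∂(itemPrior P x γ)

/-- The posterior law of `θ` given a history and the value `γ` of the meta parameter. -/
def itemPosterior (x : Fin N → Feature d) {t : ℕ} (h : Hist N t) (γ : Feature d) :
    Measure (Fin N → ℝ) :=
  bayes (itemPrior P x γ) (likelihood P h)

variable {𝒜 : Finset (Finset (Fin N))}

/-- One round of MTSS: draw `γ'` from the posterior of `γ` given the history, draw `θ'` from the
posterior of `θ` given the history and `γ'`, and act greedily for `θ'`. This is the conditional
probability, given the history, that the action is `a`. -/
def actionProb (G : GreedyRule P 𝒜) (x : Fin N → Feature d) {t : ℕ} (h : Hist N t)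
    (a : Finset (Fin N)) : ℝ≥0∞ :=
  ∫⁻ γ', itemPosterior P x h γ' {θ' | G.choice θ' = a} ∂(metaPosterior P x h)

/-- The law of the history after one more round of MTSS, when the history so far is `h` and the
true item parameters are `θ`. -/
def step (G : GreedyRule P 𝒜) (x : Fin N → Feature d) (θ : Fin N → ℝ) {t : ℕ} (h : Hist N t) :
    Measure (Hist N (t + 1)) :=
  ∑ a ∈ 𝒜, actionProb P G x h a •
    (obsLaw P θ a).map fun y => (Fin.snoc h ⟨a, y⟩ : Hist N (t + 1))

/-- The law of the history of the first `t` rounds of MTSS when the item parameters are `θ`. -/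
def histLaw (G : GreedyRule P 𝒜) (x : Fin N → Feature d) (θ : Fin N → ℝ) :
    (t : ℕ) → Measure (Hist N t)
  | 0 => Measure.dirac Fin.elim0
  | t + 1 => (histLaw G x θ t).bind (step P G x θ)

/-- The expected cumulative regret of MTSS over `T` rounds when the item parameters are `θ`. -/
def regret (G : GreedyRule P 𝒜) (h𝒜 : 𝒜.Nonempty) (x : Fin N → Feature d) (T : ℕ)
    (θ : Fin N → ℝ) : ℝ≥0∞ :=
  ∑ t ∈ Finset.range T, ∫⁻ h, ∑ a ∈ 𝒜, actionProb P G x h a * ENNReal.ofReal (gap P 𝒜 h𝒜 θ a)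
    ∂(histLaw P G x θ t)

/-- The Bayes regret of MTSS over `T` rounds: the features have the joint law `ρ`, independently
of `γ`, they are known to the agent, and `γ` and `θ` have their prior laws. -/
def bayesRegret (G : GreedyRule P 𝒜) (h𝒜 : 𝒜.Nonempty) (ρ : Measure (Fin N → Feature d))
    (T : ℕ) : ℝ≥0∞ :=
  ∫⁻ x, ∫⁻ γ, ∫⁻ θ, regret P G h𝒜 x T θ ∂(itemPrior P x γ) ∂(metaPrior P) ∂ρ

end Model

/-- The factor `c₁` of the regret bound. -/
def c₁ {d : ℕ} (P : Params d) (N T : ℕ) : ℝ :=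
  4 * √((maxEigenvalue P.S + (P.σ₁ : ℝ) ^ 2) /
      (2 * Real.log (1 + (maxEigenvalue P.S + (P.σ₁ : ℝ) ^ 2) / (P.σ₂ : ℝ) ^ 2)) *
    Real.log (4 * N * (T : ℝ) ^ 2))

/-- The regret bound. -/
def regretBound {d : ℕ} (P : Params d) (N K T : ℕ) : ℝ :=
  c₁ P N T * K * √((T : ℝ) * d) *
      √(Real.log (1 + N * maxEigenvalue P.S / ((P.σ₁ : ℝ) ^ 2 + (P.σ₂ : ℝ) ^ 2 / T))) +
    c₁ P N T * √((N : ℝ) * T * K) *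
      √(Real.log (1 + (P.σ₁ : ℝ) ^ 2 / (P.σ₂ : ℝ) ^ 2 * T)) +
    K * √(2 / (N : ℝ) * (maxEigenvalue P.S + (P.σ₁ : ℝ) ^ 2))

end SemiBandit

end

/-!
Write `s₁ = σ₁²`, `s₂ = σ₂²`, `lam` for the largest eigenvalue of `S` and `V = lam + s₁`, a bound on
the prior variances of the item parameters.

Drawing `γ'` from the posterior law of `γ` and then `θ'` from the posterior law of `θ` given `γ'` is
drawing `θ'` from the posterior law of `θ` with `γ` integrated out (`actionProb_eq`). Hence, given
the history, the action has the same law as the optimal action. Let `M i` and `V i` be the posterior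
mean and variance of `θ i`. The regret of a round, averaged over the posterior, is the posterior
mean of `∑ i ∈ choice θ, (θ i - M i)`, since the mean reward of the action is `∑ i ∈ a, M i`. For
any `β > 0` this is at most `β ∑ i ∈ choice θ, √(V i)` plus the excess of the parameters over the
bounds `M i + β √(V i)`, and as the posterior laws are Gaussian this excess is of order
`exp (-β² / 2)` (`lintegral_regret_round_le`). The choice `β² = 8 log (4 N T²)` makes the total
excess at most the last term of the bound.

Bayes' rule for the adaptively chosen actions (`lintegral_prior_histLaw`) holds because, given the
history, the actions do not depend on the parameters, so that the density of the history is the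
likelihood of the observations times a factor free of the parameters. The posterior law of `θ i` is
identified by its moment generating function: multiplying the posterior density by
`exp (τ * θ i)` is, up to a constant factor, the effect of shifting `θ` under the prior, by the
Cameron–Martin formula (`exists_lintegral_expLik_mul_exp`, `exists_posterior_map_eq`). The resulting
variance `postVar` only depends on how often each item was observed. It is the sum of the variance
of `θ i` given `γ` and of the contribution of the uncertainty about `γ`.

It remains to bound the sum of the posterior standard deviations of the chosen items along every
history (`sum_sqrt_postVar_le`). By concavity of the logarithm a variance `x ≤ V` is at most
`V / log (1 + V / s₂) * log (1 + x / s₂)`, and `log (1 + postVar / s₂)` splits exactly into a part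
for the item given `γ` and a part for `γ` (`log_one_add_postVar`). The first parts telescope along
the observations of each item to `log (1 + s₁ T / s₂)`. Each second part is, by the matrix
determinant lemma, at most the increase in that round of the logarithm of the determinant of
`precision`, the normalized posterior precision matrix of `γ`, which in total is at most
`d log (1 + N lam / (s₁ + s₂ / T))`. The two terms of the bound follow by the Cauchy–Schwarz
inequality; for the second parts, all of the at most `K` items of a round share one increase.

For the order of the bound, `V / log (1 + V / s₂) ≤ V + s₂`, and the logarithms of the bound are at
most `log (N T) + log (1 + V / s₂)`, so that small `s₂` does no harm (`div_log_mul_log_le`).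
-/

noncomputable section

namespace SemiBandit

open Matrix

/-! ### Determinants of regularized Gram matrices -/

/-- The matrix `1 + ∑ j, w j • v j (v j)ᵀ`: the posterior precision of a standard Gaussian vector
observed with precision `w j` in the direction `v j`. -/
def precision {ι κ : Type*} [Fintype ι] [Fintype κ] [DecidableEq κ] (v : ι → κ → ℝ) (w : ι → ℝ) :
    Matrix κ κ ℝ :=
  1 + ∑ j, w j • vecMulVec (v j) (v j)

lemma posSemidef_smul_vecMulVec {κ : Type*} [Fintype κ] {δ : ℝ} (hδ : 0 ≤ δ) (u : κ → ℝ) :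
    (δ • vecMulVec u u).PosSemidef := by
  simpa using (posSemidef_vecMulVec_self_star u).smul hδ

section Precision

variable {ι κ : Type*} [Fintype ι] [Fintype κ] [DecidableEq κ]

lemma precision_posDef (v : ι → κ → ℝ) {w : ι → ℝ} (hw : ∀ j, 0 ≤ w j) :
    (precision v w).PosDef :=
  PosDef.one.add_posSemidef (posSemidef_sum _ fun j _ => posSemidef_smul_vecMulVec (hw j) _)

lemma precision_mulVec (v : ι → κ → ℝ) (w : ι → ℝ) (c : κ → ℝ) :
    precision v w *ᵥ c = c + ∑ j, (w j * (v j ⬝ᵥ c)) • v j := by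
  simp only [precision, add_mulVec, one_mulVec, sum_mulVec, smul_mulVec, vecMulVec_mulVec]
  congr 1
  refine Finset.sum_congr rfl fun j _ => ?_
  ext k
  simp
  ring

lemma dotProduct_precision_mulVec (v : ι → κ → ℝ) (w : ι → ℝ) (c : κ → ℝ) :
    c ⬝ᵥ precision v w *ᵥ c = c ⬝ᵥ c + ∑ j, w j * (v j ⬝ᵥ c) ^ 2 := by
  rw [precision_mulVec, dotProduct_add, dotProduct_sum]
  congr 1
  refine Finset.sum_congr rfl fun j _ => ?_
  rw [dotProduct_smul, smul_eq_mul, dotProduct_comm c]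
  ring

lemma dotProduct_inv_mulVec_nonneg {A : Matrix κ κ ℝ} (hA : A.PosDef) (u : κ → ℝ) :
    0 ≤ u ⬝ᵥ A⁻¹ *ᵥ u := by
  simpa using hA.inv.posSemidef.dotProduct_mulVec_nonneg u

lemma dotProduct_inv_precision_le (v : ι → κ → ℝ) {w : ι → ℝ} (hw : ∀ j, 0 ≤ w j) (u : κ → ℝ) :
    u ⬝ᵥ (precision v w)⁻¹ *ᵥ u ≤ u ⬝ᵥ u := by
  have hA := precision_posDef v hw
  have hdet : IsUnit (precision v w).det := hA.det_pos.ne'.isUnit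
  set c := (precision v w)⁻¹ *ᵥ u with hc
  have huc : precision v w *ᵥ c = u := by
    rw [hc, mulVec_mulVec, mul_nonsing_inv _ hdet, one_mulVec]
  have h1 : c ⬝ᵥ c ≤ u ⬝ᵥ c := by
    have := dotProduct_precision_mulVec v w c
    rw [huc, dotProduct_comm] at this
    rw [this]
    have : 0 ≤ ∑ j, w j * (v j ⬝ᵥ c) ^ 2 :=
      Finset.sum_nonneg fun j _ => mul_nonneg (hw j) (sq_nonneg _)
    linarith
  have h2 : 0 ≤ (u - c) ⬝ᵥ (u - c) := by
    simpa using dotProduct_star_self_nonneg (u - c)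
  simp only [sub_dotProduct, dotProduct_sub] at h2
  rw [dotProduct_comm c u] at h2
  linarith

lemma det_add_smul_vecMulVec {A : Matrix κ κ ℝ} (hA : A.PosDef) (δ : ℝ) (u : κ → ℝ) :
    (A + δ • vecMulVec u u).det = A.det * (1 + δ * (u ⬝ᵥ A⁻¹ *ᵥ u)) := by
  have h : δ • vecMulVec u u = replicateCol Unit (δ • u) * replicateRow Unit u := by
    ext i j
    simp [vecMulVec_apply, mul_apply]
    ring
  rw [h, det_add_replicateCol_mul_replicateRow hA.det_pos.ne'.isUnit]
  congr 1
  rw [det_unique, Matrix.add_apply, Matrix.one_apply_eq, Matrix.mul_assoc,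
    ← replicateCol_mulVec, replicateRow_mul_replicateCol_apply, mulVec_smul, dotProduct_smul,
    smul_eq_mul]

lemma det_le_det_add_sum {ι κ : Type*} [Fintype κ] [DecidableEq κ] {A : Matrix κ κ ℝ} (hA : A.PosDef) (v : ι → κ → ℝ) {δ : ι → ℝ}
    (hδ : ∀ j, 0 ≤ δ j) (s : Finset ι) :
    A.det ≤ (A + ∑ j ∈ s, δ j • vecMulVec (v j) (v j)).det := by
  classical
  induction s using Finset.induction_on with
  | empty => simp
  | insert i s hi ih =>
    have hB : (A + ∑ j ∈ s, δ j • vecMulVec (v j) (v j)).PosDef :=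
      hA.add_posSemidef (posSemidef_sum _ fun j _ => posSemidef_smul_vecMulVec (hδ j) _)
    rw [Finset.sum_insert hi, add_comm (δ i • _), ← add_assoc, det_add_smul_vecMulVec hB]
    refine ih.trans (le_mul_of_one_le_right hB.det_pos.le ?_)
    have := mul_nonneg (hδ i) (dotProduct_inv_mulVec_nonneg hB (v i))
    linarith

/-- Increasing all the observation precisions increases the determinant at least by the factor that
the increase in a single direction accounts for. -/
lemma det_precision_mul_le (v : ι → κ → ℝ) {w w' : ι → ℝ} (hw : ∀ j, 0 ≤ w j)
    (hww : ∀ j, w j ≤ w' j) (i : ι) :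
    (precision v w).det * (1 + (w' i - w i) * (v i ⬝ᵥ (precision v w)⁻¹ *ᵥ v i)) ≤
      (precision v w').det := by
  classical
  have hA := precision_posDef v hw
  rw [← det_add_smul_vecMulVec hA]
  have hB := hA.add_posSemidef (posSemidef_smul_vecMulVec (sub_nonneg.2 (hww i)) (v i))
  refine (det_le_det_add_sum hB v (fun j => sub_nonneg.2 (hww j)) (Finset.univ.erase i)).trans_eq ?_
  rw [add_assoc, Finset.add_sum_erase _ (fun j => (w' j - w j) • vecMulVec (v j) (v j))
    (Finset.mem_univ i), precision, precision, add_assoc, ← Finset.sum_add_distrib]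
  simp [← add_smul]

lemma det_precision_le (v : ι → κ → ℝ) {w : ι → ℝ} (hw : ∀ j, 0 ≤ w j) {b : ℝ}
    (hb : ∀ c : κ → ℝ, ∑ j, w j * (v j ⬝ᵥ c) ^ 2 ≤ b * (c ⬝ᵥ c)) :
    (precision v w).det ≤ (1 + b) ^ Fintype.card κ := by
  have hA := precision_posDef v hw
  rw [hA.1.det_eq_prod_eigenvalues]
  refine (Finset.prod_le_prod (fun k _ => ?_) (fun k _ => ?_)).trans_eq (Finset.prod_const _)
  · simpa using (hA.eigenvalues_pos k).le
  · -- an eigenvalue is the value of the quadratic form at a unit eigenvector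
    set c : κ → ℝ := ⇑(hA.1.eigenvectorBasis k) with hc
    have hcc : c ⬝ᵥ c = 1 := by
      have := hA.1.eigenvectorBasis.norm_eq_one k
      have h2 : (‖hA.1.eigenvectorBasis k‖ : ℝ) ^ 2 = c ⬝ᵥ c := by
        rw [EuclideanSpace.real_norm_sq_eq]
        simp [dotProduct, hc, sq]
      rw [← h2, this, one_pow]
    have h1 := hA.1.mulVec_eigenvectorBasis k
    have h3 := dotProduct_precision_mulVec v w c
    rw [hc, h1, dotProduct_smul, ← hc, hcc] at h3
    have := hb c
    rw [hcc] at this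
    simp at h3 ⊢
    linarith

end Precision

/-! ### The posterior variances and their sum along a sequence of actions -/

/-- The posterior variance of an item with prior variance `s₁` after `n` observations with noise
variance `s₂`. -/
def condVar (s₁ s₂ : ℝ) (n : ℕ) : ℝ := s₁ * s₂ / (s₂ + n * s₁)

/-- The weight that the prior mean of an item has in its posterior mean after `n` observations. -/
def shrink (s₁ s₂ : ℝ) (n : ℕ) : ℝ := s₂ / (s₂ + n * s₁)

/-- The precision with which `n` observations of an item determine its prior mean: the inverse of
`s₁ + s₂ / n`. -/
def effPrec (s₁ s₂ : ℝ) (n : ℕ) : ℝ := n / (s₂ + n * s₁)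

/-- The posterior variance of the `i`-th item when item `j` has been observed `n j` times. The item
parameters are `⟪v j, g⟫ + z j` plus constants, with `g` a standard Gaussian vector and `z j` of
variance `s₁`. The first summand is the variance given `g`, the second one the contribution of the
uncertainty about `g`. -/
def postVar {ι κ : Type*} [Fintype ι] [Fintype κ] [DecidableEq κ] (s₁ s₂ : ℝ) (v : ι → κ → ℝ)
    (n : ι → ℕ) (i : ι) : ℝ :=
  condVar s₁ s₂ (n i) + shrink s₁ s₂ (n i) ^ 2 *
    (v i ⬝ᵥ (precision v fun j => effPrec s₁ s₂ (n j))⁻¹ *ᵥ v i)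

section Scalars

variable {s₁ s₂ : ℝ}

lemma condVar_pos (h₁ : 0 < s₁) (h₂ : 0 < s₂) (n : ℕ) : 0 < condVar s₁ s₂ n := by
  unfold condVar; positivity

lemma effPrec_nonneg (h₁ : 0 < s₁) (h₂ : 0 < s₂) (n : ℕ) : 0 ≤ effPrec s₁ s₂ n := by
  unfold effPrec; positivity

lemma effPrec_mono (h₁ : 0 < s₁) (h₂ : 0 < s₂) : Monotone (effPrec s₁ s₂) := by
  intro m n h
  have h' : (m : ℝ) ≤ n := by exact_mod_cast h
  unfold effPrec
  rw [div_le_div_iff₀ (by positivity) (by positivity)]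
  nlinarith

lemma effPrec_le (h₁ : 0 < s₁) (h₂ : 0 < s₂) {n T : ℕ} (hT : 0 < T) (h : n ≤ T) :
    effPrec s₁ s₂ n ≤ 1 / (s₁ + s₂ / T) := by
  refine (effPrec_mono h₁ h₂ h).trans_eq ?_
  have : (0 : ℝ) < T := by exact_mod_cast hT
  unfold effPrec
  field_simp
  ring

lemma sum_log_one_add_condVar (h₁ : 0 < s₁) (h₂ : 0 < s₂) (m : ℕ) :
    ∑ k ∈ Finset.range m, Real.log (1 + condVar s₁ s₂ k / s₂) = Real.log (1 + s₁ / s₂ * m) := by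
  induction m with
  | zero => simp
  | succ m ih =>
    rw [Finset.sum_range_succ, ih, ← Real.log_mul (by positivity)
      (by have := condVar_pos h₁ h₂ m; positivity)]
    congr 1
    unfold condVar
    push_cast
    field_simp
    ring

/-- On `[0, V]` the concave function `log (1 + x / s)` lies above its chord. -/
lemma le_mul_log_one_add {s V x : ℝ} (hs : 0 < s) (hV : 0 < V) (hx : 0 ≤ x) (hxV : x ≤ V) :
    x ≤ V / Real.log (1 + V / s) * Real.log (1 + x / s) := by
  have hy : 0 < V / s := by positivity
  have hlog : 0 < Real.log (1 + V / s) := Real.log_pos (by linarith)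
  have h1 := rpow_one_add_le_one_add_mul_self (s := V / s) (p := x / V) (by linarith)
    (by positivity) ((div_le_one hV).2 hxV)
  have h2 := Real.log_le_log (by positivity) h1
  rw [Real.log_rpow (by positivity), show x / V * (V / s) = x / s by field_simp] at h2
  calc x = V / Real.log (1 + V / s) * (x / V * Real.log (1 + V / s)) := by
        generalize Real.log (1 + V / s) = L at hlog
        field_simp
    _ ≤ _ := by gcongr

end Scalars

section PostVar

variable {ι κ : Type*} [Fintype ι] [Fintype κ] [DecidableEq κ] {s₁ s₂ : ℝ}

lemma precision_effPrec_posDef (h₁ : 0 < s₁) (h₂ : 0 < s₂) (v : ι → κ → ℝ) (n : ι → ℕ) :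
    (precision v fun j => effPrec s₁ s₂ (n j)).PosDef :=
  precision_posDef v fun _ => effPrec_nonneg h₁ h₂ _

lemma postVar_pos (h₁ : 0 < s₁) (h₂ : 0 < s₂) (v : ι → κ → ℝ) (n : ι → ℕ) (i : ι) :
    0 < postVar s₁ s₂ v n i :=
  add_pos_of_pos_of_nonneg (condVar_pos h₁ h₂ _) (mul_nonneg (sq_nonneg _)
    (dotProduct_inv_mulVec_nonneg (precision_effPrec_posDef h₁ h₂ v n) _))

lemma postVar_le (h₁ : 0 < s₁) (h₂ : 0 < s₂) (v : ι → κ → ℝ) (n : ι → ℕ) (i : ι) :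
    postVar s₁ s₂ v n i ≤ v i ⬝ᵥ v i + s₁ := by
  have h3 := dotProduct_inv_precision_le v (fun j => effPrec_nonneg h₁ h₂ (n j)) (v i)
  have h4 := dotProduct_inv_mulVec_nonneg (precision_effPrec_posDef h₁ h₂ v n) (v i)
  have h5 : condVar s₁ s₂ (n i) ≤ s₁ := by
    unfold condVar
    rw [div_le_iff₀ (by positivity)]
    have : 0 ≤ s₁ * (n i * s₁) := by positivity
    linarith
  have h6 : shrink s₁ s₂ (n i) ^ 2 ≤ 1 := by
    unfold shrink
    refine pow_le_one₀ (by positivity) ?_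
    rw [div_le_one (by positivity)]
    have : 0 ≤ n i * s₁ := by positivity
    linarith
  unfold postVar
  have := mul_le_of_le_one_left h4 h6
  linarith

/-- The information that the next observation of an item carries is the sum of the information
about the item given the meta parameter and of the information about the meta parameter. -/
lemma log_one_add_postVar (h₁ : 0 < s₁) (h₂ : 0 < s₂) (v : ι → κ → ℝ) (n : ι → ℕ) (i : ι) :
    Real.log (1 + postVar s₁ s₂ v n i / s₂) = Real.log (1 + condVar s₁ s₂ (n i) / s₂) +
      Real.log (1 + (effPrec s₁ s₂ (n i + 1) - effPrec s₁ s₂ (n i)) *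
        (v i ⬝ᵥ (precision v fun j => effPrec s₁ s₂ (n j))⁻¹ *ᵥ v i)) := by
  have h4 := dotProduct_inv_mulVec_nonneg (precision_effPrec_posDef h₁ h₂ v n) (v i)
  have h5 := condVar_pos h₁ h₂ (n i)
  have h6 : 0 ≤ effPrec s₁ s₂ (n i + 1) - effPrec s₁ s₂ (n i) :=
    sub_nonneg.2 (effPrec_mono h₁ h₂ (Nat.le_succ _))
  rw [← Real.log_mul (by positivity) (by positivity)]
  congr 1
  unfold postVar
  generalize v i ⬝ᵥ (precision v fun j => effPrec s₁ s₂ (n j))⁻¹ *ᵥ v i = q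
  unfold condVar effPrec shrink
  have : (0 : ℝ) < s₂ + n i * s₁ := by positivity
  have : (0 : ℝ) < s₂ + (n i + 1) * s₁ := by positivity
  push_cast
  field_simp
  ring

end PostVar

/-- How often item `i` has been chosen in the first `t` rounds of the sequence of actions `A`. -/
def cnt {ι : Type*} [DecidableEq ι] (A : ℕ → Finset ι) (t : ℕ) (i : ι) : ℕ :=
  (Finset.range t).sum fun l => if i ∈ A l then 1 else 0

section Count

variable {ι : Type*} [DecidableEq ι]

lemma cnt_succ (A : ℕ → Finset ι) (t : ℕ) (i : ι) :
    cnt A (t + 1) i = cnt A t i + if i ∈ A t then 1 else 0 :=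
  Finset.sum_range_succ _ _

lemma cnt_le (A : ℕ → Finset ι) (t : ℕ) (i : ι) : cnt A t i ≤ t := by
  refine (Finset.sum_le_card_nsmul _ _ 1 fun l _ => ?_).trans (by simp)
  split_ifs <;> simp

lemma sum_ite_mem_cnt (A : ℕ → Finset ι) (f : ℕ → ℝ) (T : ℕ) (i : ι) :
    ∑ t ∈ Finset.range T, (if i ∈ A t then f (cnt A t i) else 0) =
      ∑ k ∈ Finset.range (cnt A T i), f k := by
  induction T with
  | zero => simp [cnt]
  | succ T ih =>
    rw [Finset.sum_range_succ, ih, cnt_succ]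
    split_ifs
    · rw [Finset.sum_range_succ]
    · simp

end Count

section Potential

variable {ι κ : Type*} [Fintype ι] [DecidableEq ι] [Fintype κ] [DecidableEq κ] {s₁ s₂ : ℝ}

/-- The total information about the items given the meta parameter. -/
lemma sum_log_condVar_le (h₁ : 0 < s₁) (h₂ : 0 < s₂) (A : ℕ → Finset ι) (T : ℕ) :
    ∑ t ∈ Finset.range T, ∑ i ∈ A t, Real.log (1 + condVar s₁ s₂ (cnt A t i) / s₂) ≤
      Fintype.card ι * Real.log (1 + s₁ / s₂ * T) := by
  have h : ∀ t, ∑ i ∈ A t, Real.log (1 + condVar s₁ s₂ (cnt A t i) / s₂) =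
      ∑ i, if i ∈ A t then Real.log (1 + condVar s₁ s₂ (cnt A t i) / s₂) else 0 := fun t => by
    simp
  simp_rw [h]
  rw [Finset.sum_comm]
  refine (Finset.sum_le_card_nsmul _ _ (Real.log (1 + s₁ / s₂ * T)) fun i _ => ?_).trans_eq
    (by simp)
  rw [sum_ite_mem_cnt A fun k => Real.log (1 + condVar s₁ s₂ k / s₂),
    sum_log_one_add_condVar h₁ h₂]
  gcongr
  exact cnt_le _ _ _

/-- The potential of the meta parameter after `t` rounds: twice the information that the
observations made so far carry about it. -/
def logDet (s₁ s₂ : ℝ) (v : ι → κ → ℝ) (A : ℕ → Finset ι) (t : ℕ) : ℝ :=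
  Real.log (precision v fun j => effPrec s₁ s₂ (cnt A t j)).det

lemma log_increment_le (h₁ : 0 < s₁) (h₂ : 0 < s₂) (v : ι → κ → ℝ) (A : ℕ → Finset ι) (t : ℕ)
    {i : ι} (hi : i ∈ A t) :
    Real.log (1 + (effPrec s₁ s₂ (cnt A t i + 1) - effPrec s₁ s₂ (cnt A t i)) *
        (v i ⬝ᵥ (precision v fun j => effPrec s₁ s₂ (cnt A t j))⁻¹ *ᵥ v i)) ≤
      logDet s₁ s₂ v A (t + 1) - logDet s₁ s₂ v A t := by
  have hA := precision_effPrec_posDef h₁ h₂ v (cnt A t)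
  have h4 := dotProduct_inv_mulVec_nonneg hA (v i)
  have h6 : 0 ≤ effPrec s₁ s₂ (cnt A t i + 1) - effPrec s₁ s₂ (cnt A t i) :=
    sub_nonneg.2 (effPrec_mono h₁ h₂ (Nat.le_succ _))
  have hd := hA.det_pos
  have := det_precision_mul_le v (w' := fun j => effPrec s₁ s₂ (cnt A (t + 1) j))
    (fun j => effPrec_nonneg h₁ h₂ (cnt A t j))
    (fun j => effPrec_mono h₁ h₂ ((cnt_succ A t j).symm ▸ Nat.le_add_right _ _)) i
  simp only [cnt_succ A t i, hi, if_true] at this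
  have := Real.log_le_log (by positivity) this
  rw [Real.log_mul (by positivity) (by positivity)] at this
  unfold logDet
  linarith

lemma logDet_mono (h₁ : 0 < s₁) (h₂ : 0 < s₂) (v : ι → κ → ℝ) (A : ℕ → Finset ι) (t : ℕ) :
    0 ≤ logDet s₁ s₂ v A (t + 1) - logDet s₁ s₂ v A t := by
  have hA := precision_effPrec_posDef h₁ h₂ v (cnt A t)
  have := det_le_det_add_sum hA v (δ := fun j => effPrec s₁ s₂ (cnt A (t + 1) j) -
    effPrec s₁ s₂ (cnt A t j)) (fun j => sub_nonneg.2 (effPrec_mono h₁ h₂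
      ((cnt_succ A t j).symm ▸ Nat.le_add_right _ _))) Finset.univ
  rw [precision, add_assoc, ← Finset.sum_add_distrib] at this
  simp only [← add_smul, add_sub_cancel] at this
  exact sub_nonneg.2 (Real.log_le_log hA.det_pos this)

lemma logDet_zero (s₁ s₂ : ℝ) (v : ι → κ → ℝ) (A : ℕ → Finset ι) : logDet s₁ s₂ v A 0 = 0 := by
  simp [logDet, cnt, precision, effPrec]

lemma logDet_le (h₁ : 0 < s₁) (h₂ : 0 < s₂) {v : ι → κ → ℝ} {lam : ℝ}
    (hv : ∀ j c, (v j ⬝ᵥ c) ^ 2 ≤ lam * (c ⬝ᵥ c)) (A : ℕ → Finset ι) {T : ℕ} (hT : 0 < T) :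
    logDet s₁ s₂ v A T ≤
      Fintype.card κ * Real.log (1 + Fintype.card ι * lam / (s₁ + s₂ / T)) := by
  have hA := precision_effPrec_posDef h₁ h₂ v (cnt A T)
  rw [logDet, ← Real.log_pow]
  refine Real.log_le_log hA.det_pos (det_precision_le v (fun j => effPrec_nonneg h₁ h₂ _)
    fun c => ?_)
  calc ∑ j, effPrec s₁ s₂ (cnt A T j) * (v j ⬝ᵥ c) ^ 2
      ≤ ∑ _j : ι, 1 / (s₁ + s₂ / T) * (lam * (c ⬝ᵥ c)) := by
        refine Finset.sum_le_sum fun j _ => ?_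
        exact mul_le_mul (effPrec_le h₁ h₂ hT (cnt_le _ _ _)) (hv j c) (sq_nonneg _)
          (by positivity)
    _ = _ := by
        rw [Finset.sum_const, Finset.card_univ, nsmul_eq_mul]
        ring

/-- The elliptical potential argument: a bound on the sum of the posterior standard deviations of
the chosen items. The summation is over subsets `B t` of the chosen sets `A t`. -/
lemma sum_sqrt_postVar_le (h₁ : 0 < s₁) (h₂ : 0 < s₂) {v : ι → κ → ℝ} {lam : ℝ} (hlam : 0 ≤ lam)
    (hv : ∀ j c, (v j ⬝ᵥ c) ^ 2 ≤ lam * (c ⬝ᵥ c)) (hvv : ∀ j, v j ⬝ᵥ v j ≤ lam)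
    {A B : ℕ → Finset ι} {K : ℕ} (hBA : ∀ t, B t ⊆ A t) (hB : ∀ t, (B t).card ≤ K)
    {T : ℕ} (hT : 0 < T) :
    ∑ t ∈ Finset.range T, ∑ i ∈ B t, √(postVar s₁ s₂ v (cnt A t) i) ≤
      √((lam + s₁) / Real.log (1 + (lam + s₁) / s₂)) *
        (K * √((T : ℝ) * Fintype.card κ) *
            √(Real.log (1 + Fintype.card ι * lam / (s₁ + s₂ / T))) +
          √((Fintype.card ι : ℝ) * T * K) * √(Real.log (1 + s₁ / s₂ * T))) := by
  set V := lam + s₁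
  have hV : 0 < V := by positivity
  set R := √(V / Real.log (1 + V / s₂))
  let f : ℕ → ι → ℝ := fun t i => Real.log (1 + condVar s₁ s₂ (cnt A t i) / s₂)
  let D : ℕ → ℝ := fun t => logDet s₁ s₂ v A (t + 1) - logDet s₁ s₂ v A t
  have hf : ∀ t i, 0 ≤ f t i := fun t i => Real.log_nonneg (by
    have := condVar_pos h₁ h₂ (cnt A t i)
    have : 0 ≤ condVar s₁ s₂ (cnt A t i) / s₂ := by positivity
    linarith)
  have hD : ∀ t, 0 ≤ D t := logDet_mono h₁ h₂ v A
  have key : ∀ t, ∀ i ∈ B t, √(postVar s₁ s₂ v (cnt A t) i) ≤ R * (√(D t) + √(f t i)) := by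
    intro t i hi
    have hp := postVar_pos h₁ h₂ v (cnt A t) i
    have hle : postVar s₁ s₂ v (cnt A t) i ≤ V :=
      (postVar_le h₁ h₂ v _ i).trans (by linarith [hvv i])
    have hL : 0 < Real.log (1 + V / s₂) := by
      refine Real.log_pos ?_
      have : 0 < V / s₂ := by positivity
      linarith
    calc √(postVar s₁ s₂ v (cnt A t) i)
        ≤ √(V / Real.log (1 + V / s₂) * Real.log (1 + postVar s₁ s₂ v (cnt A t) i / s₂)) :=
          Real.sqrt_le_sqrt (le_mul_log_one_add h₂ hV hp.le hle)
      _ = R * √(Real.log (1 + postVar s₁ s₂ v (cnt A t) i / s₂)) :=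
          Real.sqrt_mul (by positivity) _
      _ ≤ R * √(D t + f t i) := by
          gcongr
          rw [log_one_add_postVar h₁ h₂, add_comm]
          gcongr
          exact log_increment_le h₁ h₂ v A t (hBA t hi)
      _ ≤ _ := by
          gcongr
          rw [Real.sqrt_le_left (by positivity), add_sq, Real.sq_sqrt (hD t), Real.sq_sqrt (hf t i)]
          have : 0 ≤ 2 * √(D t) * √(f t i) := by positivity
          linarith
  have hsum : ∑ t ∈ Finset.range T, D t = logDet s₁ s₂ v A T := by
    rw [Finset.sum_range_sub, logDet_zero, sub_zero]
  have first : ∑ t ∈ Finset.range T, ∑ _i ∈ B t, √(D t) ≤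
      K * √((T : ℝ) * Fintype.card κ) *
            √(Real.log (1 + Fintype.card ι * lam / (s₁ + s₂ / T))) := by
    calc ∑ t ∈ Finset.range T, ∑ _i ∈ B t, √(D t)
        ≤ ∑ t ∈ Finset.range T, K * √(D t) := by
          refine Finset.sum_le_sum fun t _ => ?_
          rw [Finset.sum_const, nsmul_eq_mul]
          gcongr
          exact hB t
      _ = K * ∑ t ∈ Finset.range T, √1 * √(D t) := by simp [Finset.mul_sum]
      _ ≤ K * (√(∑ t ∈ Finset.range T, (1 : ℝ)) * √(∑ t ∈ Finset.range T, D t)) := by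
          gcongr
          exact Real.sum_sqrt_mul_sqrt_le _ (fun _ => zero_le_one) hD
      _ ≤ K * (√(T : ℝ) * √(Fintype.card κ *
            Real.log (1 + Fintype.card ι * lam / (s₁ + s₂ / T)))) := by
          rw [hsum]
          simp only [Finset.sum_const, Finset.card_range, nsmul_eq_mul, mul_one]
          gcongr
          exact logDet_le h₁ h₂ hv A hT
      _ = _ := by
          rw [Real.sqrt_mul (by positivity), Real.sqrt_mul (by positivity)]
          ring
  have second : ∑ t ∈ Finset.range T, ∑ i ∈ B t, √(f t i) ≤
      √((Fintype.card ι : ℝ) * T * K) * √(Real.log (1 + s₁ / s₂ * T)) := by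
    rw [Finset.sum_sigma']
    calc ∑ x ∈ (Finset.range T).sigma B, √(f x.1 x.2)
        = ∑ x ∈ (Finset.range T).sigma B, √1 * √(f x.1 x.2) := by simp
      _ ≤ √(∑ x ∈ (Finset.range T).sigma B, (1 : ℝ)) *
            √(∑ x ∈ (Finset.range T).sigma B, f x.1 x.2) :=
          Real.sum_sqrt_mul_sqrt_le _ (fun _ => zero_le_one) fun x => hf _ _
      _ ≤ √((T : ℝ) * K) * √(Fintype.card ι * Real.log (1 + s₁ / s₂ * T)) := by
          gcongr
          · rw [Finset.sum_const, nsmul_eq_mul, mul_one, Finset.card_sigma]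
            have := Finset.sum_le_card_nsmul (Finset.range T) (fun t => (B t).card) K
              fun t _ => hB t
            rw [Finset.card_range, smul_eq_mul] at this
            exact_mod_cast this
          · rw [← Finset.sum_sigma' (Finset.range T) B f]
            refine le_trans (Finset.sum_le_sum fun t _ => ?_) (sum_log_condVar_le h₁ h₂ A T)
            exact Finset.sum_le_sum_of_subset_of_nonneg (hBA t) fun i _ _ => hf t i
      _ = _ := by
          rw [← Real.sqrt_mul (by positivity), ← Real.sqrt_mul (by positivity)]
          congr 1
          ring
  calc ∑ t ∈ Finset.range T, ∑ i ∈ B t, √(postVar s₁ s₂ v (cnt A t) i)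
      ≤ ∑ t ∈ Finset.range T, ∑ i ∈ B t, R * (√(D t) + √(f t i)) :=
        Finset.sum_le_sum fun t _ => Finset.sum_le_sum fun i hi => key t i hi
    _ = R * (∑ t ∈ Finset.range T, ∑ _i ∈ B t, √(D t) +
          ∑ t ∈ Finset.range T, ∑ i ∈ B t, √(f t i)) := by
        simp only [← Finset.mul_sum, ← Finset.sum_add_distrib]
    _ ≤ _ := by gcongr

end Potential

/-! ### Exponential tilting of Gaussian measures -/

lemma pi_withDensity_ofReal {ι : Type*} [Fintype ι] (ν : ι → Measure ℝ) [∀ i, SigmaFinite (ν i)]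
    {f : ι → ℝ → ℝ} (hf0 : ∀ i x, 0 ≤ f i x) (hf : ∀ i, Integrable (f i) (ν i)) :
    Measure.pi (fun i => (ν i).withDensity fun x => ENNReal.ofReal (f i x)) =
      (Measure.pi ν).withDensity fun x => ∏ i, ENNReal.ofReal (f i (x i)) := by
  have : ∀ i, IsFiniteMeasure ((ν i).withDensity fun x => ENNReal.ofReal (f i x)) := fun i =>
    isFiniteMeasure_withDensity_ofReal (hf i).2
  refine Measure.pi_eq fun s hs => ?_
  rw [withDensity_apply _ (MeasurableSet.univ_pi hs), Measure.restrict_pi_pi]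
  have h : ∀ x : ι → ℝ, ∏ i, ENNReal.ofReal (f i (x i)) = ENNReal.ofReal (∏ i, f i (x i)) :=
    fun x => (ENNReal.ofReal_prod_of_nonneg fun i _ => hf0 i _).symm
  have hf' : ∀ i, Integrable (f i) ((ν i).restrict (s i)) := fun i => (hf i).restrict
  simp_rw [h]
  rw [← ofReal_integral_eq_lintegral_ofReal (Integrable.fintype_prod_dep hf')
      (Filter.Eventually.of_forall fun x => Finset.prod_nonneg fun i _ => hf0 i _),
    integral_fintype_prod_eq_prod, ENNReal.ofReal_prod_of_nonneg
      fun i _ => integral_nonneg fun x => hf0 i x]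
  refine Finset.prod_congr rfl fun i _ => ?_
  rw [withDensity_apply _ (hs i), ofReal_integral_eq_lintegral_ofReal (hf' i)
    (Filter.Eventually.of_forall (hf0 i))]

lemma gaussianReal_withDensity_exp (b : ℝ) :
    (gaussianReal 0 1).withDensity (fun z => ENNReal.ofReal (Real.exp (b * z - b ^ 2 / 2))) =
      gaussianReal b 1 := by
  rw [gaussianReal_of_var_ne_zero _ one_ne_zero, gaussianReal_of_var_ne_zero _ one_ne_zero,
    ← withDensity_mul _ (measurable_gaussianPDF _ _) (by fun_prop)]
  congr 1
  ext z
  simp only [gaussianPDF, Pi.mul_apply]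
  rw [← ENNReal.ofReal_mul (gaussianPDFReal_nonneg _ _ _)]
  congr 1
  simp only [gaussianPDFReal]
  rw [mul_assoc, ← Real.exp_add]
  congr 2
  simp
  ring

/-- The law of a standard Gaussian vector indexed by `ι`. -/
abbrev stdNormal (ι : Type*) [Fintype ι] : Measure (ι → ℝ) :=
  Measure.pi fun _ : ι => gaussianReal 0 1

/-- The Cameron–Martin formula: exponential tilting of a standard Gaussian vector is a shift. -/
lemma lintegral_exp_stdNormal {ι : Type*} [Fintype ι] {f : (ι → ℝ) → ℝ≥0∞} (hf : Measurable f)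
    (b : ι → ℝ) :
    ∫⁻ z, f z * ENNReal.ofReal (Real.exp (b ⬝ᵥ z)) ∂(stdNormal ι) =
      ENNReal.ofReal (Real.exp (b ⬝ᵥ b / 2)) * ∫⁻ z, f (z + b) ∂(stdNormal ι) := by
  have h1 : Measure.pi (fun i => gaussianReal (b i) 1) =
      (stdNormal ι).withDensity fun z =>
        ENNReal.ofReal (Real.exp (b ⬝ᵥ z) * Real.exp (-(b ⬝ᵥ b / 2))) := by
    rw [show (fun i => gaussianReal (b i) 1) = fun i => (gaussianReal 0 1).withDensity
      (fun z => ENNReal.ofReal (Real.exp (b i * z - b i ^ 2 / 2))) from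
        funext fun i => (gaussianReal_withDensity_exp (b i)).symm,
      pi_withDensity_ofReal _ (fun i x => (Real.exp_pos _).le)]
    · congr 1
      ext z
      rw [← ENNReal.ofReal_prod_of_nonneg fun i _ => (Real.exp_pos _).le, ← Real.exp_sum,
        ← Real.exp_add, dotProduct, dotProduct, Finset.sum_div, ← sub_eq_add_neg,
        ← Finset.sum_sub_distrib]
      simp [sq]
    · intro i
      simp_rw [Real.exp_sub]
      exact (integrable_exp_mul_gaussianReal _).div_const _
  have h2 : Measure.pi (fun i => gaussianReal (b i) 1) = (stdNormal ι).map fun z => z + b := by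
    have h : ∀ i, gaussianReal (b i) 1 = (gaussianReal 0 1).map fun z => z + b i := fun i => by
      rw [gaussianReal_map_add_const, zero_add]
    simp_rw [h]
    have : ∀ i, IsProbabilityMeasure ((gaussianReal 0 1).map fun z => z + b i) := fun i =>
      Measure.isProbabilityMeasure_map (by fun_prop)
    exact (Measure.pi_map_pi (fun i => by fun_prop)).symm
  have h3 : ∫⁻ z, f (z + b) ∂(stdNormal ι) = ∫⁻ z, f z * ENNReal.ofReal (Real.exp (b ⬝ᵥ z) *
      Real.exp (-(b ⬝ᵥ b / 2))) ∂(stdNormal ι) := by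
    rw [← lintegral_map hf (by fun_prop), ← h2, h1,
      lintegral_withDensity_eq_lintegral_mul _ (by unfold dotProduct; fun_prop) hf]
    exact lintegral_congr fun z => mul_comm _ _
  rw [h3, ← lintegral_const_mul _ (by unfold dotProduct; fun_prop)]
  refine lintegral_congr fun z => ?_
  rw [mul_left_comm, ← ENNReal.ofReal_mul (Real.exp_pos _).le, mul_left_comm, ← Real.exp_add]
  simp

/-! ### Gaussian linear mixed models and their posterior laws -/

/-- The item parameters of a Gaussian linear mixed model as a function of standard Gaussian
vectors. -/
def mixedMap {ι κ : Type*} [Fintype κ] (m : ι → ℝ) (v : ι → κ → ℝ) (σ : ℝ)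
    (p : (κ → ℝ) × (ι → ℝ)) : ι → ℝ :=
  fun j => m j + v j ⬝ᵥ p.1 + σ * p.2 j

/-- The law of `(m j + ⟪v j, g⟫ + σ z j)_j` for independent standard Gaussian vectors `g`, `z`. -/
def mixedGaussian {ι κ : Type*} [Fintype ι] [Fintype κ] (m : ι → ℝ) (v : ι → κ → ℝ) (σ : ℝ) :
    Measure (ι → ℝ) :=
  ((stdNormal κ).prod (stdNormal ι)).map (mixedMap m v σ)

section Mixed

variable {ι κ : Type*} [Fintype ι] [Fintype κ]

lemma measurable_mixedMap {ι κ : Type*} [Fintype κ] (m : ι → ℝ) (v : ι → κ → ℝ) (σ : ℝ) :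
    Measurable (mixedMap m v σ) := by
  unfold mixedMap dotProduct
  fun_prop

instance (m : ι → ℝ) (v : ι → κ → ℝ) (σ : ℝ) : IsProbabilityMeasure (mixedGaussian m v σ) :=
  Measure.isProbabilityMeasure_map (measurable_mixedMap m v σ).aemeasurable

lemma lintegral_mixedGaussian (m : ι → ℝ) (v : ι → κ → ℝ) (σ : ℝ) {f : (ι → ℝ) → ℝ≥0∞}
    (hf : Measurable f) :
    ∫⁻ θ, f θ ∂(mixedGaussian m v σ) =
      ∫⁻ g, ∫⁻ z, f (mixedMap m v σ (g, z)) ∂(stdNormal ι) ∂(stdNormal κ) := by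
  rw [mixedGaussian, lintegral_map hf (measurable_mixedMap m v σ), lintegral_prod]
  exact (hf.comp (measurable_mixedMap m v σ)).aemeasurable

/-- The covariance matrix of `mixedGaussian m v σ` applied to the vector `b`. -/
def mixedCov (v : ι → κ → ℝ) (σ : ℝ) (b : ι → ℝ) : ι → ℝ :=
  fun j => σ ^ 2 * b j + v j ⬝ᵥ ∑ k, b k • v k

/-- Exponential tilting of the law of the item parameters is a shift. -/
lemma lintegral_exp_mixedGaussian (m : ι → ℝ) (v : ι → κ → ℝ) (σ : ℝ) {f : (ι → ℝ) → ℝ≥0∞}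
    (hf : Measurable f) (b : ι → ℝ) :
    ∫⁻ θ, f θ * ENNReal.ofReal (Real.exp (b ⬝ᵥ (θ - m))) ∂(mixedGaussian m v σ) =
      ENNReal.ofReal (Real.exp (b ⬝ᵥ mixedCov v σ b / 2)) *
        ∫⁻ θ, f (θ + mixedCov v σ b) ∂(mixedGaussian m v σ) := by
  set u : κ → ℝ := ∑ k, b k • v k with hu
  have hM := measurable_mixedMap m v σ
  have hbu : ∀ g, b ⬝ᵥ (fun j => v j ⬝ᵥ g) = u ⬝ᵥ g := fun g => by
    rw [hu, sum_dotProduct]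
    simp only [dotProduct, Pi.smul_apply, smul_eq_mul, Finset.mul_sum, mul_assoc]
  have hdec : ∀ g z, b ⬝ᵥ (mixedMap m v σ (g, z) - m) = u ⬝ᵥ g + (σ • b) ⬝ᵥ z := fun g z => by
    rw [← hbu, smul_dotProduct, ← dotProduct_smul, ← dotProduct_add]
    congr 1
    ext j
    simp [mixedMap]
    ring
  have hshift : ∀ g z, mixedMap m v σ (g + u, z + σ • b) =
      mixedMap m v σ (g, z) + mixedCov v σ b := fun g z => by
    ext j
    simp [mixedMap, mixedCov, ← hu]
    ring
  have hquad : b ⬝ᵥ mixedCov v σ b / 2 = u ⬝ᵥ u / 2 + (σ • b) ⬝ᵥ (σ • b) / 2 := by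
    rw [← hbu, smul_dotProduct, dotProduct_smul, ← add_div, smul_smul, ← sq, ← dotProduct_smul,
      ← dotProduct_add]
    congr 2
    ext j
    simp [mixedCov, ← hu]
    ring
  have hm1 : Measurable fun p : (κ → ℝ) × (ι → ℝ) => f (mixedMap m v σ (p.1, p.2)) := hf.comp hM
  have hm2 : Measurable fun g : κ → ℝ =>
      ∫⁻ z, f (mixedMap m v σ (g, z + σ • b)) ∂(stdNormal ι) := by
    refine Measurable.lintegral_prod_right'
      (f := fun p : (κ → ℝ) × (ι → ℝ) => f (mixedMap m v σ (p.1, p.2 + σ • b))) ?_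
    exact hm1.comp (measurable_fst.prodMk (measurable_snd.add_const _))
  rw [lintegral_mixedGaussian m v σ (by unfold dotProduct; fun_prop),
    lintegral_mixedGaussian m v σ (f := fun θ => f (θ + mixedCov v σ b))
      (hf.comp (measurable_id.add_const _))]
  calc ∫⁻ g, ∫⁻ z, f (mixedMap m v σ (g, z)) *
        ENNReal.ofReal (Real.exp (b ⬝ᵥ (mixedMap m v σ (g, z) - m))) ∂(stdNormal ι) ∂(stdNormal κ)
      = ∫⁻ g, (ENNReal.ofReal (Real.exp ((σ • b) ⬝ᵥ (σ • b) / 2)) *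
          ∫⁻ z, f (mixedMap m v σ (g, z + σ • b)) ∂(stdNormal ι)) *
            ENNReal.ofReal (Real.exp (u ⬝ᵥ g)) ∂(stdNormal κ) := by
        refine lintegral_congr fun g => ?_
        have hfg : Measurable fun z => f (mixedMap m v σ (g, z)) :=
          hm1.comp (measurable_const.prodMk measurable_id)
        rw [← lintegral_exp_stdNormal hfg, ← lintegral_mul_const
          (f := fun z => f (mixedMap m v σ (g, z)) * ENNReal.ofReal (Real.exp ((σ • b) ⬝ᵥ z))) _
          (hfg.mul (by unfold dotProduct; fun_prop))]
        refine lintegral_congr fun z => ?_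
        rw [hdec, Real.exp_add, ENNReal.ofReal_mul (Real.exp_pos _).le, mul_assoc,
          mul_comm (ENNReal.ofReal (Real.exp (u ⬝ᵥ g)))]
    _ = _ := by
        rw [lintegral_exp_stdNormal (hm2.const_mul _),
          lintegral_const_mul (f := fun g =>
            ∫⁻ z, f (mixedMap m v σ (g + u, z + σ • b)) ∂(stdNormal ι)) _
            (hm2.comp (measurable_id.add_const u)), ← mul_assoc,
          ← ENNReal.ofReal_mul (Real.exp_pos _).le, ← Real.exp_add, ← hquad]
        simp_rw [hshift]

variable [DecidableEq ι] [DecidableEq κ]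

/-- The direction `b` in which the tilt of the prior law has the effect of tilting the posterior law
along the `i`-th coordinate. -/
lemma exists_tilt_direction {σ s₂ : ℝ} (h₁ : 0 < σ) (h₂ : 0 < s₂) (v : ι → κ → ℝ) (n : ι → ℕ)
    (i : ι) : ∃ b : ι → ℝ, (∀ j, b j + n j / s₂ * mixedCov v σ b j = Pi.single (M := fun _ => ℝ) i 1 j) ∧
      mixedCov v σ b i = postVar (σ ^ 2) s₂ v n i := by
  have h₁' : 0 < σ ^ 2 := by positivity
  set A := precision v fun j => effPrec (σ ^ 2) s₂ (n j) with hA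
  have hdet : IsUnit A.det := (precision_effPrec_posDef h₁' h₂ v n).det_pos.ne'.isUnit
  set ρ := shrink (σ ^ 2) s₂ (n i) with hρ
  -- `c` is the effect of the tilt on the standard Gaussian vector `g`
  set c : κ → ℝ := ρ • (A⁻¹ *ᵥ v i) with hc
  let b : ι → ℝ := fun j => ρ * Pi.single (M := fun _ => ℝ) i 1 j -
    effPrec (σ ^ 2) s₂ (n j) * (v j ⬝ᵥ c)
  have hAc : A *ᵥ c = ρ • v i := by
    rw [hc, mulVec_smul, mulVec_mulVec, mul_nonsing_inv _ hdet, one_mulVec]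
  have hbv : ∑ k, b k • v k = c := by
    have h := precision_mulVec v (fun j => effPrec (σ ^ 2) s₂ (n j)) c
    rw [← hA, hAc] at h
    simp only [b, sub_smul, Finset.sum_sub_distrib]
    rw [show ∑ k, (ρ * Pi.single (M := fun _ => ℝ) i 1 k) • v k = ρ • v i by
      simp [Pi.single_apply], h]
    abel
  have hcov : ∀ j, mixedCov v σ b j = σ ^ 2 * b j + v j ⬝ᵥ c := fun j => by
    rw [mixedCov, hbv]
  refine ⟨b, fun j => ?_, ?_⟩
  · rw [hcov]
    have hpos : 0 < s₂ + n j * σ ^ 2 := by positivity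
    by_cases hj : j = i
    · subst hj
      simp only [b, Pi.single_eq_same, hρ, shrink, effPrec]
      field_simp
      ring
    · simp only [b, Pi.single_eq_of_ne hj, effPrec]
      field_simp
      ring
  · rw [hcov]
    have hpos : 0 < s₂ + n i * σ ^ 2 := by positivity
    have hvc : v i ⬝ᵥ c = ρ * (v i ⬝ᵥ A⁻¹ *ᵥ v i) := by rw [hc, dotProduct_smul, smul_eq_mul]
    simp only [b, Pi.single_eq_same, hvc, postVar, ← hA]
    generalize v i ⬝ᵥ A⁻¹ *ᵥ v i = q
    simp only [hρ, shrink, effPrec, condVar]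
    field_simp
    ring

/-- The likelihood function, up to a constant factor, of item parameters that were observed `n j`
times with sum of observations `y j` and noise variance `s₂`. -/
def expLik (s₂ : ℝ) (n : ι → ℕ) (y : ι → ℝ) (θ : ι → ℝ) : ℝ≥0∞ :=
  ENNReal.ofReal (Real.exp (∑ j, (y j * θ j - n j * θ j ^ 2 / 2) / s₂))

/-- The moment generating function of the posterior law of an item parameter is Gaussian. -/
lemma exists_lintegral_expLik_mul_exp (m : ι → ℝ) (v : ι → κ → ℝ) {σ s₂ : ℝ} (h₁ : 0 < σ)
    (h₂ : 0 < s₂) (n : ι → ℕ) (y : ι → ℝ) (i : ι) :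
    ∃ M : ℝ, ∀ τ : ℝ,
      ∫⁻ θ, expLik s₂ n y θ * ENNReal.ofReal (Real.exp (τ * θ i)) ∂(mixedGaussian m v σ) =
        ENNReal.ofReal (Real.exp (M * τ + postVar (σ ^ 2) s₂ v n i * τ ^ 2 / 2)) *
          ∫⁻ θ, expLik s₂ n y θ ∂(mixedGaussian m v σ) := by
  obtain ⟨b, hb, hV⟩ := exists_tilt_direction h₁ h₂ v n i
  set k := mixedCov v σ b with hk
  set V := postVar (σ ^ 2) s₂ v n i
  have hmeas : Measurable (expLik s₂ n y) := by unfold expLik; fun_prop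
  refine ⟨∑ j, y j * k j / s₂ + b ⬝ᵥ m, fun τ => ?_⟩
  have hcov : mixedCov v σ (τ • b) = τ • k := by
    ext j
    simp only [mixedCov, hk, Pi.smul_apply, smul_eq_mul, mul_add, ← smul_smul, ← Finset.smul_sum,
      dotProduct_smul]
    ring
  have htilt := lintegral_exp_mixedGaussian m v σ (f := fun θ => expLik s₂ n y (θ - τ • k))
    (hmeas.comp (measurable_id.sub_const _)) (τ • b)
  rw [hcov] at htilt
  simp only [add_sub_cancel_right] at htilt
  have hbk : V = b ⬝ᵥ k + ∑ j, n j / s₂ * k j ^ 2 := by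
    rw [← hV, dotProduct, ← Finset.sum_add_distrib]
    calc k i = ∑ j, Pi.single (M := fun _ => ℝ) i 1 j * k j := by simp [Pi.single_apply]
      _ = _ := Finset.sum_congr rfl fun j _ => by rw [← hb j]; ring
  have hexp : ∀ θ : ι → ℝ, expLik s₂ n y θ * ENNReal.ofReal (Real.exp (τ * θ i)) =
      ENNReal.ofReal (Real.exp ((∑ j, y j * k j / s₂ + b ⬝ᵥ m) * τ +
        (∑ j, n j / s₂ * k j ^ 2) * τ ^ 2 / 2)) *
        (expLik s₂ n y (θ - τ • k) * ENNReal.ofReal (Real.exp ((τ • b) ⬝ᵥ (θ - m)))) := by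
    intro θ
    have hθ : θ i = ∑ j, (b j + n j / s₂ * k j) * θ j := by
      simp [hb, Pi.single_apply]
    unfold expLik
    simp only [← ENNReal.ofReal_mul (Real.exp_pos _).le, ← Real.exp_add]
    congr 2
    rw [hθ]
    simp only [dotProduct, Finset.sum_mul, Finset.mul_sum, Finset.sum_div, add_mul,
      ← Finset.sum_add_distrib, Pi.smul_apply, Pi.sub_apply, smul_eq_mul]
    refine Finset.sum_congr rfl fun j _ => ?_
    ring
  simp_rw [hexp]
  rw [lintegral_const_mul' _ _ ENNReal.ofReal_ne_top, htilt, ← mul_assoc,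
    ← ENNReal.ofReal_mul (Real.exp_pos _).le, ← Real.exp_add, hbk]
  congr 3
  simp only [smul_dotProduct, dotProduct_smul, smul_eq_mul]
  ring

end Mixed

/-- A probability measure on the line with a Gaussian moment generating function is Gaussian. -/
lemma eq_gaussianReal_of_lintegral_exp {ν : Measure ℝ} [IsProbabilityMeasure ν] {M : ℝ} {V : ℝ≥0}
    (h : ∀ τ : ℝ, ∫⁻ x, ENNReal.ofReal (Real.exp (τ * x)) ∂ν =
      ENNReal.ofReal (Real.exp (M * τ + V * τ ^ 2 / 2))) :
    ν = gaussianReal M V := by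
  have hint : ∀ τ : ℝ, Integrable (fun x => Real.exp (τ * x)) ν := fun τ => by
    refine ⟨by fun_prop, ?_⟩
    rw [hasFiniteIntegral_iff_ofReal (Filter.Eventually.of_forall fun x => (Real.exp_pos _).le), h]
    exact ENNReal.ofReal_lt_top
  have hmgf : mgf id ν = mgf id (gaussianReal M V) := by
    rw [mgf_id_gaussianReal]
    ext τ
    simp only [mgf, id]
    rw [integral_eq_lintegral_of_nonneg_ae (Filter.Eventually.of_forall fun x => (Real.exp_pos _).le)
      (by fun_prop), h, ENNReal.toReal_ofReal (Real.exp_pos _).le]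
  have hset : integrableExpSet id ν = Set.univ := Set.eq_univ_of_forall hint
  refine Measure.ext_of_complexMGF_id_eq (funext fun z => ?_)
  exact eqOn_complexMGF_of_mgf hmgf (by simp [hset])

/-! ### Measurability on the space of histories -/

section Histories

variable {N : ℕ}

lemma measurable_sigmaMk {α : Type*} {β : α → Type*} [∀ a, MeasurableSpace (β a)] (a : α) :
    Measurable (Sigma.mk a : β a → Sigma β) :=
  fun _ hs => MeasurableSpace.measurableSet_iInf.1 hs a

lemma measurable_of_sigmaMk {α γ : Type*} {β : α → Type*} [∀ a, MeasurableSpace (β a)]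
    [MeasurableSpace γ] {f : Sigma β → γ} (hf : ∀ a, Measurable fun y => f ⟨a, y⟩) :
    Measurable f :=
  fun _ hs => MeasurableSpace.measurableSet_iInf.2 fun a => hf a hs

/-- The observation of item `i` in a record, or `0` if the item was not chosen. -/
def obsOf (r : Record N) (i : Fin N) : ℝ := if h : i ∈ r.1 then r.2 ⟨i, h⟩ else 0

lemma measurable_obsOf (i : Fin N) : Measurable fun r : Record N => obsOf r i := by
  refine measurable_of_sigmaMk fun a => ?_
  unfold obsOf
  by_cases h : i ∈ a
  · simpa only [h, dite_true] using measurable_pi_apply (⟨i, h⟩ : a)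
  · simp only [h, dite_false]
    fun_prop

lemma measurableSet_fst (q : Finset (Fin N) → Prop) : MeasurableSet {r : Record N | q r.1} := by
  refine MeasurableSpace.measurableSet_iInf.2 fun a => ?_
  change MeasurableSet {y : a → ℝ | q a}
  exact MeasurableSet.const _

lemma prod_record (r : Record N) (f : Fin N → ℝ → ℝ≥0∞) :
    ∏ i : r.1, f i.1 (r.2 i) = ∏ i, if i ∈ r.1 then f i (obsOf r i) else 1 := by
  rw [Finset.prod_ite_mem, Finset.univ_inter, ← Finset.prod_coe_sort r.1]
  exact Finset.prod_congr rfl fun i _ => by simp [obsOf]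

lemma measurable_snoc {t : ℕ} (a : Finset (Fin N)) :
    Measurable fun p : Hist N t × (a → ℝ) => (Fin.snoc p.1 ⟨a, p.2⟩ : Hist N (t + 1)) := by
  refine measurable_pi_iff.2 fun l => ?_
  refine Fin.lastCases ?_ (fun l => ?_) l
  · simp only [Fin.snoc_last]
    exact (measurable_sigmaMk a).comp measurable_snd
  · simp only [Fin.snoc_castSucc]
    exact (measurable_pi_apply l).comp measurable_fst

/-- Functions of the sequence of actions in a history are measurable. -/
lemma measurable_of_actions {t : ℕ} {γ : Type*} [MeasurableSpace γ]
    (f : (Fin t → Finset (Fin N)) → γ) : Measurable fun h : Hist N t => f fun l => (h l).1 := by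
  let _ : MeasurableSpace (Finset (Fin N)) := ⊤
  have h1 : Measurable fun r : Record N => r.1 := fun s _ => measurableSet_fst (· ∈ s)
  have h2 : Measurable fun h : Hist N t => fun l => (h l).1 :=
    measurable_pi_iff.2 fun l => h1.comp (measurable_pi_apply l)
  exact (measurable_of_countable f).comp h2

end Histories

/-! ### The likelihood of the item parameters -/

section Likelihood

variable {N d : ℕ} (P : Params d)

lemma Params.var_ne_zero : P.σ₂ ^ 2 ≠ 0 := pow_ne_zero _ P.σ₂_pos.ne'

lemma likelihood_eq {t : ℕ} (h : Hist N t) (θ : Fin N → ℝ) :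
    likelihood P h θ =
      ∏ l, ∏ i, if i ∈ (h l).1 then gaussianPDF (θ i) (P.σ₂ ^ 2) (obsOf (h l) i) else 1 :=
  Finset.prod_congr rfl fun l _ => prod_record (h l) fun i y => gaussianPDF (θ i) (P.σ₂ ^ 2) y

lemma measurable_likelihood {t : ℕ} :
    Measurable fun p : Hist N t × (Fin N → ℝ) => likelihood P p.1 p.2 := by
  simp_rw [likelihood_eq]
  refine Finset.measurable_prod _ fun l _ => Finset.measurable_prod _ fun i _ => ?_
  refine Measurable.ite ?_ ?_ measurable_const
  · exact (measurableSet_fst (i ∈ ·)).preimage ((measurable_pi_apply l).comp measurable_fst)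
  · have hy : Measurable fun p : Hist N t × (Fin N → ℝ) => obsOf (p.1 l) i :=
      (measurable_obsOf i).comp ((measurable_pi_apply l).comp measurable_fst)
    exact measurable_uncurry_gaussianPDF.comp (f := fun p : Hist N t × (Fin N → ℝ) =>
      (p.2 i, P.σ₂ ^ 2, obsOf (p.1 l) i)) (by fun_prop)

lemma measurable_likelihood_right {t : ℕ} (h : Hist N t) : Measurable (likelihood P h) :=
  (measurable_likelihood P).comp (f := fun θ => (h, θ)) measurable_prodMk_left

lemma gaussianPDF_le (μ : ℝ) (v : ℝ≥0) (y : ℝ) :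
    gaussianPDF μ v y ≤ ENNReal.ofReal (√(2 * Real.pi * v))⁻¹ := by
  refine ENNReal.ofReal_le_ofReal ?_
  rw [gaussianPDFReal]
  refine mul_le_of_le_one_right (by positivity) (Real.exp_le_one_iff.2 ?_)
  exact div_nonpos_of_nonpos_of_nonneg (neg_nonpos.2 (sq_nonneg _)) (by positivity)

lemma lintegral_likelihood_ne_top {t : ℕ} (h : Hist N t) (π : Measure (Fin N → ℝ))
    [IsProbabilityMeasure π] : ∫⁻ θ, likelihood P h θ ∂π ≠ ∞ := by
  have hle : ∀ θ, likelihood P h θ ≤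
      ∏ l, ∏ _i : (h l).1, ENNReal.ofReal (√(2 * Real.pi * (P.σ₂ ^ 2 : ℝ≥0)))⁻¹ := fun θ =>
    Finset.prod_le_prod' fun l _ => Finset.prod_le_prod' fun i _ => gaussianPDF_le _ _ _
  refine ((lintegral_mono hle).trans_lt ?_).ne
  rw [lintegral_const, measure_univ, mul_one]
  exact ENNReal.prod_lt_top fun l _ => ENNReal.prod_lt_top fun i _ => ENNReal.ofReal_lt_top

lemma lintegral_likelihood_ne_zero {t : ℕ} (h : Hist N t) (π : Measure (Fin N → ℝ))
    [IsProbabilityMeasure π] : ∫⁻ θ, likelihood P h θ ∂π ≠ 0 := by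
  intro h0
  rw [lintegral_eq_zero_iff (measurable_likelihood_right P h)] at h0
  obtain ⟨θ, hθ⟩ := h0.exists
  refine Finset.prod_ne_zero_iff.2 (fun l _ => Finset.prod_ne_zero_iff.2 fun i _ => ?_) hθ
  exact (gaussianPDF_pos _ P.var_ne_zero _).ne'

/-- The number of observations of an item in a history. -/
def obsCount {t : ℕ} (h : Hist N t) (i : Fin N) : ℕ := ∑ l, if i ∈ (h l).1 then 1 else 0

lemma gaussianPDF_eq_mul (θ : ℝ) {v : ℝ≥0} (hv : v ≠ 0) (y : ℝ) :
    gaussianPDF θ v y = gaussianPDF 0 v y *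
      ENNReal.ofReal (Real.exp ((y * θ - θ ^ 2 / 2) / v)) := by
  have hv' : (v : ℝ) ≠ 0 := by exact_mod_cast hv
  rw [gaussianPDF, gaussianPDF, ← ENNReal.ofReal_mul (gaussianPDFReal_nonneg _ _ _),
    gaussianPDFReal, gaussianPDFReal, mul_assoc _ (Real.exp _), ← Real.exp_add]
  congr 3
  field_simp
  ring

/-- As a function of the parameters, the likelihood is that of one Gaussian observation for every
item. -/
lemma exists_likelihood_eq_expLik {t : ℕ} (h : Hist N t) :
    ∃ (C : ℝ≥0∞) (y : Fin N → ℝ), C ≠ 0 ∧ C ≠ ∞ ∧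
      ∀ θ, likelihood P h θ = C * expLik ((P.σ₂ : ℝ) ^ 2) (obsCount h) y θ := by
  refine ⟨likelihood P h 0, fun i => ∑ l, if i ∈ (h l).1 then obsOf (h l) i else 0, ?_, ?_,
    fun θ => ?_⟩
  · simpa [lintegral_dirac' _ (measurable_likelihood_right P h)] using
      lintegral_likelihood_ne_zero P h (Measure.dirac 0)
  · simpa [lintegral_dirac' _ (measurable_likelihood_right P h)] using
      lintegral_likelihood_ne_top P h (Measure.dirac 0)
  · have hexp : expLik ((P.σ₂ : ℝ) ^ 2) (obsCount h)
        (fun i => ∑ l, if i ∈ (h l).1 then obsOf (h l) i else 0) θ =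
        ∏ l, ∏ i, ENNReal.ofReal (Real.exp (if i ∈ (h l).1 then
          (obsOf (h l) i * θ i - θ i ^ 2 / 2) / (P.σ₂ ^ 2 : ℝ≥0) else 0)) := by
      simp_rw [← ENNReal.ofReal_prod_of_nonneg fun i _ => (Real.exp_pos _).le, ← Real.exp_sum]
      rw [← ENNReal.ofReal_prod_of_nonneg fun i _ => (Real.exp_pos _).le, ← Real.exp_sum, expLik,
        Finset.sum_comm]
      congr 2
      refine Finset.sum_congr rfl fun i _ => ?_
      simp only [obsCount, Nat.cast_sum, Finset.sum_mul, Finset.sum_div, ← Finset.sum_sub_distrib]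
      refine Finset.sum_congr rfl fun l _ => ?_
      split_ifs <;> simp
    rw [hexp, likelihood_eq, likelihood_eq, ← Finset.prod_mul_distrib]
    refine Finset.prod_congr rfl fun l _ => ?_
    rw [← Finset.prod_mul_distrib]
    refine Finset.prod_congr rfl fun i _ => ?_
    split_ifs
    · exact gaussianPDF_eq_mul _ P.var_ne_zero _
    · simp

lemma likelihood_snoc {t : ℕ} (h : Hist N t) (a : Finset (Fin N)) (y : a → ℝ) (θ : Fin N → ℝ) :
    likelihood P (Fin.snoc h ⟨a, y⟩ : Hist N (t + 1)) θ =
      likelihood P h θ * ∏ i : a, gaussianPDF (θ i) (P.σ₂ ^ 2) (y i) := by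
  rw [likelihood_eq, Fin.prod_univ_castSucc, likelihood_eq]
  simp only [Fin.snoc_castSucc, Fin.snoc_last]
  rw [← prod_record ⟨a, y⟩ fun i y => gaussianPDF (θ i) (P.σ₂ ^ 2) y]

lemma obsLaw_eq_withDensity (θ : Fin N → ℝ) (a : Finset (Fin N)) :
    obsLaw P θ a = volume.withDensity fun y => ∏ i : a, gaussianPDF (θ i) (P.σ₂ ^ 2) (y i) := by
  have h := pi_withDensity_ofReal (fun _ : a => (volume : Measure ℝ))
    (f := fun i => gaussianPDFReal (θ i) (P.σ₂ ^ 2)) (fun i x => gaussianPDFReal_nonneg _ _ _)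
    (fun i => integrable_gaussianPDFReal _ _)
  rw [obsLaw, volume_pi]
  simp_rw [gaussianReal_of_var_ne_zero _ P.var_ne_zero]
  exact h

instance (θ : Fin N → ℝ) (a : Finset (Fin N)) : IsProbabilityMeasure (obsLaw P θ a) := by
  unfold obsLaw; infer_instance

lemma measurable_prod_gaussianPDF (a : Finset (Fin N)) :
    Measurable fun p : (Fin N → ℝ) × (a → ℝ) =>
      ∏ i : a, gaussianPDF (p.1 i) (P.σ₂ ^ 2) (p.2 i) := by
  refine Finset.measurable_prod _ fun i _ => ?_
  exact measurable_uncurry_gaussianPDF.comp (f := fun p : (Fin N → ℝ) × (a → ℝ) =>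
    (p.1 i, P.σ₂ ^ 2, p.2 i)) (by fun_prop)

lemma lintegral_obsLaw (θ : Fin N → ℝ) (a : Finset (Fin N)) {F : (a → ℝ) → ℝ≥0∞}
    (hF : Measurable F) : ∫⁻ y, F y ∂(obsLaw P θ a) =
      ∫⁻ y, (∏ i : a, gaussianPDF (θ i) (P.σ₂ ^ 2) (y i)) * F y := by
  have h : Measurable fun y : a → ℝ => ∏ i : a, gaussianPDF (θ i) (P.σ₂ ^ 2) (y i) :=
    (measurable_prod_gaussianPDF P a).comp (f := fun y => (θ, y)) measurable_prodMk_left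
  rw [obsLaw_eq_withDensity, lintegral_withDensity_eq_lintegral_mul _ h hF]
  rfl

end Likelihood

/-! ### The prior and the posterior law of the item parameters -/

section Prior

variable {N d : ℕ} (P : Params d) (x : Fin N → Feature d)

/-- The prior means of the item parameters. -/
def priorMean (j : Fin N) : ℝ := inner ℝ (x j) P.μ

open scoped MatrixOrder in
/-- The features, multiplied by the square root of the covariance matrix of the meta parameter. -/
def loading (j : Fin N) : Fin d → ℝ := CFC.sqrt P.S *ᵥ (x j).ofLp

/-- The prior law of the item parameters, with the meta parameter integrated out. -/
def prior : Measure (Fin N → ℝ) := mixedGaussian (priorMean P x) (loading P x) P.σ₁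

instance : IsProbabilityMeasure (prior P x) := by unfold prior; infer_instance

instance (γ : Feature d) : IsProbabilityMeasure (itemPrior P x γ) := by
  unfold itemPrior; infer_instance

lemma itemPrior_eq_map (γ : Feature d) :
    itemPrior P x γ = (stdNormal (Fin N)).map fun z i => inner ℝ (x i) γ + P.σ₁ * z i := by
  have h : ∀ i, gaussianReal (inner ℝ (x i) γ) (P.σ₁ ^ 2) =
      (gaussianReal 0 1).map fun z => inner ℝ (x i) γ + P.σ₁ * z := fun i => by
    have h2 : (fun z : ℝ => inner ℝ (x i) γ + P.σ₁ * z) =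
      (fun z => inner ℝ (x i) γ + z) ∘ fun z => (P.σ₁ : ℝ) * z := rfl
    rw [h2, ← Measure.map_map (by fun_prop) (by fun_prop), gaussianReal_map_const_mul,
      gaussianReal_map_const_add]
    congr 1
    · simp
    · ext; simp
  unfold itemPrior
  simp_rw [h]
  have : ∀ i, IsProbabilityMeasure
      ((gaussianReal 0 1).map fun z => inner ℝ (x i) γ + P.σ₁ * z) := fun i =>
    Measure.isProbabilityMeasure_map (by fun_prop)
  exact (Measure.pi_map_pi (fun i => by fun_prop)).symm

lemma lintegral_itemPrior {f : (Fin N → ℝ) → ℝ≥0∞} (hf : Measurable f) (γ : Feature d) :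
    ∫⁻ θ, f θ ∂(itemPrior P x γ) =
      ∫⁻ z, f (fun i => inner ℝ (x i) γ + P.σ₁ * z i) ∂(stdNormal (Fin N)) := by
  rw [itemPrior_eq_map, lintegral_map hf (by fun_prop)]

lemma measurable_lintegral_itemPrior {f : (Fin N → ℝ) → ℝ≥0∞} (hf : Measurable f) :
    Measurable fun γ => ∫⁻ θ, f θ ∂(itemPrior P x γ) := by
  simp_rw [lintegral_itemPrior P x hf]
  refine Measurable.lintegral_prod_right' (f := fun p : Feature d × (Fin N → ℝ) =>
    f fun i => inner ℝ (x i) p.1 + P.σ₁ * p.2 i) (hf.comp ?_)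
  fun_prop

open scoped MatrixOrder in
lemma metaPrior_eq_map : metaPrior P = (stdNormal (Fin d)).map fun g =>
    P.μ + toEuclideanCLM (𝕜 := ℝ) (CFC.sqrt P.S) (WithLp.toLp 2 g) := by
  rw [metaPrior, multivariateGaussian, ← map_pi_eq_stdGaussian, Measure.map_map (by fun_prop)
    (by fun_prop)]
  rfl

open scoped MatrixOrder in
lemma sqrt_isHermitian : (CFC.sqrt P.S).IsHermitian :=
  (CFC.sqrt_nonneg P.S).isSelfAdjoint

/-- The model with a random meta parameter is a Gaussian linear mixed model driven by standard
Gaussian vectors. -/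
lemma lintegral_prior {f : (Fin N → ℝ) → ℝ≥0∞} (hf : Measurable f) :
    ∫⁻ γ, ∫⁻ θ, f θ ∂(itemPrior P x γ) ∂(metaPrior P) = ∫⁻ θ, f θ ∂(prior P x) := by
  rw [metaPrior_eq_map, lintegral_map (measurable_lintegral_itemPrior P x hf) (by fun_prop), prior,
    lintegral_mixedGaussian _ _ _ hf]
  refine lintegral_congr fun g => ?_
  rw [lintegral_itemPrior P x hf]
  refine lintegral_congr fun z => ?_
  congr 1
  ext i
  rw [inner_add_right]
  simp only [mixedMap, priorMean, loading]
  congr 2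
  rw [EuclideanSpace.inner_eq_star_dotProduct]
  simp only [star_trivial, ofLp_toEuclideanCLM]
  rw [dotProduct_comm, dotProduct_mulVec, ← mulVec_transpose]
  congr 2
  rw [← conjTranspose_eq_transpose_of_trivial]
  exact sqrt_isHermitian P

/-- The posterior law of the item parameters given a history. -/
def posterior {t : ℕ} (h : Hist N t) : Measure (Fin N → ℝ) := bayes (prior P x) (likelihood P h)

lemma lintegral_bayes {α : Type*} [MeasurableSpace α] (π : Measure α) {L f : α → ℝ≥0∞}
    (hL : Measurable L) (hf : Measurable f) :
    ∫⁻ z, f z ∂(bayes π L) = (∫⁻ z, L z ∂π)⁻¹ * ∫⁻ z, L z * f z ∂π := by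
  rw [bayes, lintegral_smul_measure, lintegral_withDensity_eq_lintegral_mul _ hL hf]
  rfl

lemma lintegral_posterior {t : ℕ} (h : Hist N t) {f : (Fin N → ℝ) → ℝ≥0∞} (hf : Measurable f) :
    ∫⁻ θ, f θ ∂(posterior P x h) = (∫⁻ θ, likelihood P h θ ∂(prior P x))⁻¹ *
      ∫⁻ θ, likelihood P h θ * f θ ∂(prior P x) :=
  lintegral_bayes _ (measurable_likelihood_right P h) hf

lemma lintegral_likelihood_mul {t : ℕ} (h : Hist N t) {f : (Fin N → ℝ) → ℝ≥0∞}
    (hf : Measurable f) :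
    ∫⁻ θ, likelihood P h θ * f θ ∂(prior P x) =
      (∫⁻ θ, likelihood P h θ ∂(prior P x)) * ∫⁻ θ, f θ ∂(posterior P x h) := by
  rw [lintegral_posterior P x h hf, ← mul_assoc, ENNReal.mul_inv_cancel
    (lintegral_likelihood_ne_zero P h _) (lintegral_likelihood_ne_top P h _), one_mul]

instance {t : ℕ} (h : Hist N t) : IsProbabilityMeasure (posterior P x h) := by
  refine ⟨?_⟩
  rw [← setLIntegral_one, setLIntegral_univ, lintegral_posterior P x h measurable_const]
  simp only [mul_one]
  exact ENNReal.inv_mul_cancel (lintegral_likelihood_ne_zero P h _)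
    (lintegral_likelihood_ne_top P h _)

/-- Every item parameter has a Gaussian posterior law, with the variance `postVar`. -/
lemma exists_posterior_map_eq {t : ℕ} (h : Hist N t) (i : Fin N) :
    ∃ M : ℝ, (posterior P x h).map (fun θ => θ i) = gaussianReal M
      (postVar ((P.σ₁ : ℝ) ^ 2) ((P.σ₂ : ℝ) ^ 2) (loading P x) (obsCount h) i).toNNReal := by
  have h₁ : (0 : ℝ) < P.σ₁ := P.σ₁_pos
  have h₂ : (0 : ℝ) < (P.σ₂ : ℝ) ^ 2 := pow_pos P.σ₂_pos 2
  obtain ⟨C, y, hC0, hC, hlik⟩ := exists_likelihood_eq_expLik P h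
  obtain ⟨M, hM⟩ := exists_lintegral_expLik_mul_exp (priorMean P x) (loading P x) h₁ h₂
    (obsCount h) y i
  refine ⟨M, ?_⟩
  have hi : Measurable fun θ : Fin N → ℝ => θ i := measurable_pi_apply i
  have := Measure.isProbabilityMeasure_map (μ := posterior P x h) hi.aemeasurable
  refine eq_gaussianReal_of_lintegral_exp fun τ => ?_
  have hZ0 := lintegral_likelihood_ne_zero P h (prior P x)
  have hZ := lintegral_likelihood_ne_top P h (prior P x)
  have hpos := postVar_pos (pow_pos h₁ 2) h₂ (loading P x) (obsCount h) i
  rw [lintegral_map (by fun_prop) hi, lintegral_posterior P x h (by fun_prop),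
    Real.coe_toNNReal _ hpos.le]
  have hmul : ∫⁻ θ, likelihood P h θ * ENNReal.ofReal (Real.exp (τ * θ i)) ∂(prior P x) =
      ENNReal.ofReal (Real.exp (M * τ + postVar ((P.σ₁ : ℝ) ^ 2) ((P.σ₂ : ℝ) ^ 2) (loading P x)
        (obsCount h) i * τ ^ 2 / 2)) * ∫⁻ θ, likelihood P h θ ∂(prior P x) := by
    simp_rw [hlik, mul_assoc]
    rw [lintegral_const_mul' _ _ hC, lintegral_const_mul' _ _ hC, prior, hM, mul_left_comm]
  rw [hmul, mul_left_comm, ENNReal.inv_mul_cancel hZ0 hZ, mul_one]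

variable {𝒜 : Finset (Finset (Fin N))} {P}

/-- Drawing the meta parameter and then the item parameters from their posterior laws is drawing the
item parameters from their marginal posterior law. -/
lemma actionProb_eq (G : GreedyRule P 𝒜) {t : ℕ} (h : Hist N t) (a : Finset (Fin N)) :
    actionProb P G x h a = posterior P x h {θ | G.choice θ = a} := by
  have hL := measurable_likelihood_right P h
  have hs := G.measurableSet a
  have hLs : Measurable ({θ | G.choice θ = a}.indicator (likelihood P h)) := hL.indicator hs
  have hz := measurable_lintegral_itemPrior P x hL
  have hpost : ∀ γ, itemPosterior P x h γ {θ | G.choice θ = a} =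
      (∫⁻ θ, likelihood P h θ ∂(itemPrior P x γ))⁻¹ *
        ∫⁻ θ, {θ | G.choice θ = a}.indicator (likelihood P h) θ ∂(itemPrior P x γ) := fun γ => by
    rw [itemPosterior, bayes, Measure.smul_apply, withDensity_apply _ hs, smul_eq_mul,
      lintegral_indicator hs]
  rw [actionProb, metaPosterior, lintegral_bayes _ hz]
  · rw [lintegral_prior P x hL, posterior, bayes, Measure.smul_apply, withDensity_apply _ hs,
      smul_eq_mul, ← lintegral_indicator hs, ← lintegral_prior P x hLs]
    congr 1
    refine lintegral_congr fun γ => ?_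
    rw [hpost, ← mul_assoc, ENNReal.mul_inv_cancel (lintegral_likelihood_ne_zero P h _)
      (lintegral_likelihood_ne_top P h _), one_mul]
  · simp_rw [hpost]
    exact hz.inv.mul (measurable_lintegral_itemPrior P x hLs)

lemma measurable_actionProb (G : GreedyRule P 𝒜) (t : ℕ) (a : Finset (Fin N)) :
    Measurable fun h : Hist N t => actionProb P G x h a := by
  have hs := G.measurableSet a
  simp_rw [actionProb_eq]
  have : ∀ h : Hist N t, posterior P x h {θ | G.choice θ = a} =
      (∫⁻ θ, likelihood P h θ ∂(prior P x))⁻¹ *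
        ∫⁻ θ, likelihood P h θ * {θ | G.choice θ = a}.indicator 1 θ ∂(prior P x) := fun h => by
    rw [← lintegral_posterior P x h (measurable_one.indicator hs), lintegral_indicator_one hs]
  simp_rw [this]
  refine (measurable_likelihood P).lintegral_prod_right'.inv.mul ?_
  exact ((measurable_likelihood P).mul
    ((measurable_one.indicator hs).comp measurable_snd)).lintegral_prod_right'

lemma sum_actionProb (G : GreedyRule P 𝒜) {t : ℕ} (h : Hist N t) :
    ∑ a ∈ 𝒜, actionProb P G x h a = 1 := by
  simp_rw [actionProb_eq]
  rw [← measure_biUnion_finset (fun a _ b _ hab => Set.disjoint_left.2 fun θ h1 h2 =>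
    hab (h1.symm.trans h2)) fun a _ => G.measurableSet a]
  rw [show (⋃ a ∈ 𝒜, {θ | G.choice θ = a}) = Set.univ from Set.eq_univ_of_forall fun θ => by
    simpa using G.mem θ, measure_univ]

end Prior

/-! ### The law of the history and Bayes' rule -/

section HistoryLaw

variable {N d : ℕ} {P : Params d} {𝒜 : Finset (Finset (Fin N))} (G : GreedyRule P 𝒜)
  (x : Fin N → Feature d)

lemma measurable_snoc_right {N t : ℕ} (h : Hist N t) (a : Finset (Fin N)) :
    Measurable fun y : a → ℝ => (Fin.snoc h ⟨a, y⟩ : Hist N (t + 1)) :=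
  (measurable_snoc a).comp (f := fun y => (h, y)) measurable_prodMk_left

lemma measurable_step (θ : Fin N → ℝ) (t : ℕ) :
    Measurable fun h : Hist N t => step P G x θ h := by
  refine Measure.measurable_of_measurable_coe _ fun s hs => ?_
  simp only [step, Measure.coe_finsetSum, Finset.sum_apply, Measure.smul_apply, smul_eq_mul]
  refine Finset.measurable_sum _ fun a _ => (measurable_actionProb x G t a).mul ?_
  have h1 : ∀ h : Hist N t, (obsLaw P θ a).map (fun y => (Fin.snoc h ⟨a, y⟩ : Hist N (t + 1))) s =
      obsLaw P θ a (Prod.mk h ⁻¹' ((fun p : Hist N t × (a → ℝ) =>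
        (Fin.snoc p.1 ⟨a, p.2⟩ : Hist N (t + 1))) ⁻¹' s)) := fun h => by
    rw [Measure.map_apply (measurable_snoc_right h a) hs]
    rfl
  simp_rw [h1]
  exact measurable_measure_prodMk_left (measurable_snoc a hs)

lemma lintegral_step (θ : Fin N → ℝ) {t : ℕ} (h : Hist N t) {F : Hist N (t + 1) → ℝ≥0∞}
    (hF : Measurable F) : ∫⁻ h', F h' ∂(step P G x θ h) =
      ∑ a ∈ 𝒜, actionProb P G x h a * ∫⁻ y, F (Fin.snoc h ⟨a, y⟩) ∂(obsLaw P θ a) := by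
  rw [step, lintegral_finsetSum_measure]
  refine Finset.sum_congr rfl fun a _ => ?_
  rw [lintegral_smul_measure, lintegral_map hF (measurable_snoc_right h a), smul_eq_mul]

lemma lintegral_histLaw_zero (θ : Fin N → ℝ) {F : Hist N 0 → ℝ≥0∞} (hF : Measurable F) :
    ∫⁻ h, F h ∂(histLaw P G x θ 0) = F Fin.elim0 :=
  lintegral_dirac' _ hF

lemma lintegral_histLaw_succ (θ : Fin N → ℝ) (t : ℕ) {F : Hist N (t + 1) → ℝ≥0∞}
    (hF : Measurable F) : ∫⁻ h, F h ∂(histLaw P G x θ (t + 1)) =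
      ∫⁻ h, ∑ a ∈ 𝒜, actionProb P G x h a * ∫⁻ y, F (Fin.snoc h ⟨a, y⟩) ∂(obsLaw P θ a)
        ∂(histLaw P G x θ t) := by
  rw [histLaw, Measure.lintegral_bind (measurable_step G x θ t).aemeasurable hF.aemeasurable]
  exact lintegral_congr fun h => lintegral_step G x θ h hF

lemma isProbabilityMeasure_histLaw (θ : Fin N → ℝ) (t : ℕ) :
    IsProbabilityMeasure (histLaw P G x θ t) := by
  induction t with
  | zero => exact Measure.dirac.isProbabilityMeasure
  | succ t ih =>
    refine ⟨?_⟩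
    rw [← lintegral_one, lintegral_histLaw_succ G x θ t measurable_const]
    simp [sum_actionProb]

lemma measurable_density_mul_snoc {t : ℕ} {F : Hist N (t + 1) × (Fin N → ℝ) → ℝ≥0∞}
    (hF : Measurable F) (a : Finset (Fin N)) :
    Measurable fun q : (Hist N t × (Fin N → ℝ)) × (a → ℝ) =>
      (∏ i : a, gaussianPDF (q.1.2 i) (P.σ₂ ^ 2) (q.2 i)) * F (Fin.snoc q.1.1 ⟨a, q.2⟩, q.1.2) := by
  refine Measurable.mul ?_ (hF.comp (Measurable.prodMk ?_ (by fun_prop)))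
  · exact (measurable_prod_gaussianPDF P a).comp
      (f := fun q : (Hist N t × (Fin N → ℝ)) × (a → ℝ) => (q.1.2, q.2)) (by fun_prop)
  · exact (measurable_snoc a).comp
      (f := fun q : (Hist N t × (Fin N → ℝ)) × (a → ℝ) => (q.1.1, q.2)) (by fun_prop)

/-- The expectation of a function of the history over the next round is jointly measurable in the
history and the parameters. -/
lemma measurable_round {t : ℕ} {F : Hist N (t + 1) × (Fin N → ℝ) → ℝ≥0∞} (hF : Measurable F) :
    Measurable fun p : Hist N t × (Fin N → ℝ) => ∑ a ∈ 𝒜, actionProb P G x p.1 a *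
      ∫⁻ y, F (Fin.snoc p.1 ⟨a, y⟩, p.2) ∂(obsLaw P p.2 a) := by
  refine Finset.measurable_sum _ fun a _ =>
    ((measurable_actionProb x G t a).comp measurable_fst).mul ?_
  have h1 : ∀ p : Hist N t × (Fin N → ℝ),
      ∫⁻ y, F (Fin.snoc p.1 ⟨a, y⟩, p.2) ∂(obsLaw P p.2 a) =
      ∫⁻ y, (∏ i : a, gaussianPDF (p.2 i) (P.σ₂ ^ 2) (y i)) * F (Fin.snoc p.1 ⟨a, y⟩, p.2) :=
    fun p => lintegral_obsLaw P p.2 a (hF.comp (Measurable.prodMk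
      (measurable_snoc_right p.1 a) measurable_const))
  simp_rw [h1]
  exact (measurable_density_mul_snoc hF a).lintegral_prod_right'

lemma measurable_lintegral_histLaw (t : ℕ) {F : Hist N t × (Fin N → ℝ) → ℝ≥0∞}
    (hF : Measurable F) : Measurable fun θ => ∫⁻ h, F (h, θ) ∂(histLaw P G x θ t) := by
  induction t with
  | zero =>
    simp_rw [fun θ => lintegral_histLaw_zero G x θ (F := fun h => F (h, θ))
      (hF.comp (f := fun h => (h, θ)) measurable_prodMk_right)]
    exact hF.comp (f := fun θ => (Fin.elim0, θ)) measurable_prodMk_left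
  | succ t ih =>
    simp_rw [fun θ => lintegral_histLaw_succ G x θ t (F := fun h => F (h, θ))
      (hF.comp (f := fun h => (h, θ)) measurable_prodMk_right)]
    exact ih (measurable_round G x hF)

/-- Integration over the histories of `t` rounds with respect to the actions of the algorithm and
Lebesgue measure for the observations. The law of the history given the item parameters has the
likelihood function as density with respect to this integral. -/
def pathIntegral : (t : ℕ) → (Hist N t → ℝ≥0∞) → ℝ≥0∞
  | 0, F => F Fin.elim0
  | t + 1, F => pathIntegral t fun h => ∑ a ∈ 𝒜, actionProb P G x h a *
      ∫⁻ y : a → ℝ, F (Fin.snoc h ⟨a, y⟩)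

lemma pathIntegral_mono (t : ℕ) {F F' : Hist N t → ℝ≥0∞} (h : ∀ s, F s ≤ F' s) :
    pathIntegral G x t F ≤ pathIntegral G x t F' := by
  induction t with
  | zero => exact h _
  | succ t ih => exact ih fun s => by gcongr; exact h _

/-- The joint law of the parameters and the history, disintegrated with respect to the history: the
actions do not depend on the parameters given the history, so that Bayes' rule only involves the
likelihood of the observations. -/
lemma lintegral_prior_histLaw (t : ℕ) {F : Hist N t × (Fin N → ℝ) → ℝ≥0∞} (hF : Measurable F) :
    ∫⁻ θ, ∫⁻ h, F (h, θ) ∂(histLaw P G x θ t) ∂(prior P x) =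
      pathIntegral G x t fun h => ∫⁻ θ, likelihood P h θ * F (h, θ) ∂(prior P x) := by
  induction t with
  | zero =>
    simp_rw [fun θ => lintegral_histLaw_zero G x θ (F := fun h => F (h, θ))
      (hF.comp (f := fun h => (h, θ)) measurable_prodMk_right)]
    simp [pathIntegral, likelihood]
  | succ t ih =>
    simp_rw [fun θ => lintegral_histLaw_succ G x θ t (F := fun h => F (h, θ))
      (hF.comp (f := fun h => (h, θ)) measurable_prodMk_right)]
    refine (ih (measurable_round G x hF)).trans ?_
    rw [pathIntegral]
    congr 1
    ext h
    have hL := measurable_likelihood_right P h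
    have hI : ∀ a : Finset (Fin N), Measurable fun q : (Fin N → ℝ) × (a → ℝ) =>
        (∏ i : a, gaussianPDF (q.1 i) (P.σ₂ ^ 2) (q.2 i)) * F (Fin.snoc h ⟨a, q.2⟩, q.1) :=
      fun a => (measurable_density_mul_snoc hF a).comp
        (f := fun q : (Fin N → ℝ) × (a → ℝ) => ((h, q.1), q.2)) (by fun_prop)
    have hFa : ∀ (a : Finset (Fin N)) θ, Measurable fun y : a → ℝ => F (Fin.snoc h ⟨a, y⟩, θ) := fun a θ =>
      hF.comp (Measurable.prodMk (measurable_snoc_right h a) measurable_const)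
    simp_rw [fun a θ => lintegral_obsLaw P θ a (hFa a θ), Finset.mul_sum]
    have hmul : ∀ (a : Finset (Fin N)) θ, likelihood P h θ * (actionProb P G x h a *
          ∫⁻ y : a → ℝ, (∏ i : a, gaussianPDF (θ i) (P.σ₂ ^ 2) (y i)) *
            F (Fin.snoc h ⟨a, y⟩, θ)) =
        actionProb P G x h a * ∫⁻ y : a → ℝ, likelihood P (Fin.snoc h ⟨a, y⟩ : Hist N (t + 1)) θ *
          F (Fin.snoc h ⟨a, y⟩, θ) := fun a θ => by
      have hIθ : Measurable fun y : a → ℝ => (∏ i : a, gaussianPDF (θ i) (P.σ₂ ^ 2) (y i)) *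
          F (Fin.snoc h ⟨a, y⟩, θ) :=
        (hI a).comp (f := fun y => (θ, y)) measurable_prodMk_left
      rw [mul_left_comm, ← lintegral_const_mul _ hIθ]
      simp_rw [likelihood_snoc, mul_assoc]
    have hJ : ∀ a : Finset (Fin N), Measurable fun q : (Fin N → ℝ) × (a → ℝ) =>
        likelihood P (Fin.snoc h ⟨a, q.2⟩ : Hist N (t + 1)) q.1 *
          F (Fin.snoc h ⟨a, q.2⟩, q.1) := fun a => by
      simp_rw [likelihood_snoc, mul_assoc]
      exact (hL.comp measurable_fst).mul (hI a)
    simp_rw [hmul]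
    refine (lintegral_finsetSum _ fun a _ => (hJ a).lintegral_prod_right'.const_mul _).trans ?_
    refine Finset.sum_congr rfl fun a _ => ?_
    rw [lintegral_const_mul _ (hJ a).lintegral_prod_right',
      lintegral_lintegral_swap (hJ a).aemeasurable]

end HistoryLaw

/-! ### The regret of one round of posterior sampling -/

section Round

variable {N d : ℕ} {P : Params d} {𝒜 : Finset (Finset (Fin N))}

lemma meanReward_eq (θ : Fin N → ℝ) (a : Finset (Fin N)) :
    meanReward P θ a = ∑ i ∈ a, θ i := by
  have hi : ∀ i : a, Integrable (fun y : a → ℝ => y i) (obsLaw P θ a) := fun i =>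
    integrable_eval IsGaussian.integrable_id
  rw [meanReward, integral_finsetSum _ fun i _ => hi i, ← Finset.sum_coe_sort a]
  refine Finset.sum_congr rfl fun i _ => ?_
  have := integral_comp_eval (μ := fun i : a => gaussianReal (θ i) (P.σ₂ ^ 2)) (i := i)
    (f := fun z : ℝ => z) (by fun_prop)
  exact this.trans integral_id_gaussianReal

lemma gap_eq (G : GreedyRule P 𝒜) (h𝒜 : 𝒜.Nonempty) (θ : Fin N → ℝ) (a : Finset (Fin N)) :
    gap P 𝒜 h𝒜 θ a = ∑ i ∈ G.choice θ, θ i - ∑ i ∈ a, θ i := by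
  rw [gap, le_antisymm (Finset.sup'_le h𝒜 _ fun b hb => G.maximal θ b hb)
    (Finset.le_sup' (meanReward P θ) (G.mem θ)), meanReward_eq, meanReward_eq]

lemma gap_nonneg (h𝒜 : 𝒜.Nonempty) (θ : Fin N → ℝ) {a : Finset (Fin N)} (ha : a ∈ 𝒜) :
    0 ≤ gap P 𝒜 h𝒜 θ a :=
  sub_nonneg.2 (Finset.le_sup' (meanReward P θ) ha)

lemma choice_eq_sum (G : GreedyRule P 𝒜) (g : Finset (Fin N) → (Fin N → ℝ) → ℝ) (θ : Fin N → ℝ) :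
    g (G.choice θ) θ = ∑ a ∈ 𝒜, {θ | G.choice θ = a}.indicator (g a) θ := by
  rw [Finset.sum_eq_single (G.choice θ)]
  · exact (Set.indicator_of_mem (s := {θ' | G.choice θ' = G.choice θ}) rfl _).symm
  · exact fun b _ hb => Set.indicator_of_notMem (s := {θ' | G.choice θ' = b})
      (fun h => hb (Eq.symm h)) _
  · exact fun h => (h (G.mem θ)).elim

lemma integrable_choice (G : GreedyRule P 𝒜) {ν : Measure (Fin N → ℝ)}
    {g : Finset (Fin N) → (Fin N → ℝ) → ℝ} (hg : ∀ a, Integrable (g a) ν) :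
    Integrable (fun θ => g (G.choice θ) θ) ν := by
  simp_rw [choice_eq_sum G g]
  exact integrable_finsetSum _ fun a _ => (hg a).indicator (G.measurableSet a)

lemma integral_choice (G : GreedyRule P 𝒜) {ν : Measure (Fin N → ℝ)} [IsProbabilityMeasure ν]
    (g : Finset (Fin N) → ℝ) :
    ∫ θ, g (G.choice θ) ∂ν = ∑ a ∈ 𝒜, ν.real {θ | G.choice θ = a} * g a := by
  simp_rw [choice_eq_sum G fun a _ => g a]
  rw [integral_finsetSum _ fun a _ => (integrable_const _).indicator (G.measurableSet a)]
  refine Finset.sum_congr rfl fun a _ => ?_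
  rw [integral_indicator_const _ (G.measurableSet a), smul_eq_mul]

lemma measurable_gap (G : GreedyRule P 𝒜) (h𝒜 : 𝒜.Nonempty) (a : Finset (Fin N)) :
    Measurable fun θ => gap P 𝒜 h𝒜 θ a := by
  simp_rw [gap_eq G]
  refine Measurable.sub ?_ (by fun_prop)
  simp_rw [choice_eq_sum G fun a θ => ∑ i ∈ a, θ i]
  exact Finset.measurable_sum _ fun b _ => Measurable.indicator (by fun_prop) (G.measurableSet b)

/-- The expected regret of one round in which the action is the maximizer for a sample from the
law `ν` of the true parameters: the expected excess of the parameters over the upper confidence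
bounds `M i + β √(V i)` is exponentially small, and the rest is the expected width of the confidence
intervals of the chosen items. -/
lemma lintegral_regret_round_le (G : GreedyRule P 𝒜) (h𝒜 : 𝒜.Nonempty) {K : ℕ}
    (hK : ∀ a ∈ 𝒜, a.card ≤ K) {ν : Measure (Fin N → ℝ)} [IsProbabilityMeasure ν]
    {M V : Fin N → ℝ} (hV : ∀ i, 0 < V i)
    (hν : ∀ i, ν.map (fun θ => θ i) = gaussianReal (M i) (V i).toNNReal) {V₀ β : ℝ}
    (hV₀ : ∀ i, V i ≤ V₀) (hβ : 0 < β) :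
    ∫⁻ θ, ∑ a ∈ 𝒜, ν {θ' | G.choice θ' = a} * ENNReal.ofReal (gap P 𝒜 h𝒜 θ a) ∂ν ≤
      ENNReal.ofReal (K * (N * (√V₀ / β * Real.exp (-β ^ 2 / 2)))) +
        ∑ a ∈ 𝒜, ν {θ' | G.choice θ' = a} * ENNReal.ofReal (β * ∑ i ∈ a, √(V i)) := by
  have hi : ∀ i, Measurable fun θ : Fin N → ℝ => θ i := measurable_pi_apply
  let S : Fin N → ℝ := fun i => √(V i)
  have hS : ∀ i, 0 < S i := fun i => Real.sqrt_pos.2 (hV i)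
  let e : Fin N → (Fin N → ℝ) → ℝ := fun i θ =>
    S i / β * Real.exp (-(β * M i / S i) - β ^ 2) * Real.exp (β / S i * θ i)
  have he0 : ∀ i θ, 0 ≤ e i θ := fun i θ => by have := hS i; positivity
  have hint : ∀ i, Integrable (fun θ : Fin N → ℝ => θ i) ν := fun i => by
    have h : Integrable (fun z : ℝ => z) (ν.map fun θ => θ i) := by
      rw [hν i]; exact IsGaussian.integrable_id
    exact h.comp_measurable (hi i)
  have hmean : ∀ i, ∫ θ, θ i ∂ν = M i := fun i => by
    have h := integral_map (hi i).aemeasurable (μ := ν) (f := fun z : ℝ => z) (by fun_prop)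
    rw [← h, hν i, integral_id_gaussianReal]
  have hexp : ∀ i, Integrable (fun θ : Fin N → ℝ => Real.exp (β / S i * θ i)) ν := fun i => by
    have h : Integrable (fun z : ℝ => Real.exp (β / S i * z)) (ν.map fun θ => θ i) := by
      rw [hν i]; exact integrable_exp_mul_gaussianReal _
    exact h.comp_measurable (hi i)
  have heint : ∀ i, Integrable (e i) ν := fun i => (hexp i).const_mul _
  have hemean : ∀ i, ∫ θ, e i θ ∂ν ≤ √V₀ / β * Real.exp (-β ^ 2 / 2) := fun i => by
    have h := mgf_gaussianReal (hν i) (β / S i)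
    rw [mgf, Real.coe_toNNReal _ (hV i).le] at h
    simp only [e]
    rw [integral_const_mul, h, mul_assoc, ← Real.exp_add]
    have hVS : V i = S i ^ 2 := (Real.sq_sqrt (hV i).le).symm
    have h2 : -(β * M i / S i) - β ^ 2 + (M i * (β / S i) + V i * (β / S i) ^ 2 / 2) =
        -β ^ 2 / 2 := by
      have := hS i
      rw [hVS]
      field_simp
      ring
    rw [h2]
    have := Real.sqrt_le_sqrt (hV₀ i)
    gcongr
  -- the excess over the upper confidence bound, by `x ≤ exp x` for `x = (β / S i) * excess`
  have hexc : ∀ i θ, θ i - M i ≤ e i θ + β * S i := fun i θ => by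
    have hSi := hS i
    have h1 := Real.add_one_le_exp (β / S i * (θ i - M i - β * S i))
    have h2 : e i θ = S i / β * Real.exp (β / S i * (θ i - M i - β * S i)) := by
      simp only [e]
      rw [mul_assoc, ← Real.exp_add]
      congr 2
      field_simp
      ring
    have h3 : S i / β * (β / S i * (θ i - M i - β * S i)) ≤ e i θ := by
      rw [h2]
      gcongr
      linarith
    have h4 : S i / β * (β / S i * (θ i - M i - β * S i)) = θ i - M i - β * S i := by
      field_simp
    linarith
  have hreal : ∀ a, ν {θ' | G.choice θ' = a} = ENNReal.ofReal (ν.real {θ' | G.choice θ' = a}) :=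
    fun a => (ofReal_measureReal).symm
  have hpr : ∑ a ∈ 𝒜, ν.real {θ | G.choice θ = a} = 1 := by
    have := integral_choice G (ν := ν) fun _ => 1
    simpa using this.symm
  let H : (Fin N → ℝ) → ℝ := fun θ => ∑ i ∈ G.choice θ, θ i -
    ∑ a ∈ 𝒜, ν.real {θ' | G.choice θ' = a} * ∑ i ∈ a, θ i
  have hH : ∀ θ, H θ = ∑ a ∈ 𝒜, ν.real {θ' | G.choice θ' = a} * gap P 𝒜 h𝒜 θ a := fun θ => by
    simp only [H, gap_eq G, mul_sub, Finset.sum_sub_distrib, ← Finset.sum_mul, hpr, one_mul]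
  have hH0 : ∀ θ, 0 ≤ H θ := fun θ => by
    rw [hH]
    exact Finset.sum_nonneg fun a ha => mul_nonneg measureReal_nonneg (gap_nonneg h𝒜 θ ha)
  have hSint : Integrable (fun θ => ∑ i ∈ G.choice θ, θ i) ν :=
    integrable_choice G (g := fun a θ => ∑ i ∈ a, θ i) fun a =>
      integrable_finsetSum _ fun i _ => hint i
  have hcint : ∀ g : Finset (Fin N) → ℝ, Integrable (fun θ => g (G.choice θ)) ν := fun g =>
    integrable_choice G (g := fun a _ => g a) fun a => integrable_const _
  have hAint : ∀ a : Finset (Fin N), Integrable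
      (fun θ => ν.real {θ' | G.choice θ' = a} * ∑ i ∈ a, θ i) ν := fun a =>
    (integrable_finsetSum _ fun i _ => hint i).const_mul _
  have hHint : Integrable H ν := hSint.sub (integrable_finsetSum _ fun a _ => hAint a)
  have hlhs : ∀ θ, ∑ a ∈ 𝒜, ν {θ' | G.choice θ' = a} * ENNReal.ofReal (gap P 𝒜 h𝒜 θ a) =
      ENNReal.ofReal (H θ) := fun θ => by
    rw [hH, ENNReal.ofReal_sum_of_nonneg fun a ha =>
      mul_nonneg measureReal_nonneg (gap_nonneg h𝒜 θ ha)]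
    refine Finset.sum_congr rfl fun a _ => ?_
    rw [ENNReal.ofReal_mul measureReal_nonneg, hreal]
  have hrhs : ∑ a ∈ 𝒜, ν {θ' | G.choice θ' = a} * ENNReal.ofReal (β * ∑ i ∈ a, √(V i)) =
      ENNReal.ofReal (∑ a ∈ 𝒜, ν.real {θ' | G.choice θ' = a} * (β * ∑ i ∈ a, S i)) := by
    rw [ENNReal.ofReal_sum_of_nonneg fun a _ => by positivity]
    refine Finset.sum_congr rfl fun a _ => ?_
    rw [ENNReal.ofReal_mul measureReal_nonneg, hreal]
  simp_rw [hlhs]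
  rw [← ofReal_integral_eq_lintegral_ofReal hHint (Filter.Eventually.of_forall hH0), hrhs,
    ← ENNReal.ofReal_add (by positivity) (Finset.sum_nonneg fun a _ => by positivity)]
  refine ENNReal.ofReal_le_ofReal ?_
  have hHmean : ∫ θ, H θ ∂ν = ∫ θ, (∑ i ∈ G.choice θ, θ i - ∑ i ∈ G.choice θ, M i) ∂ν := by
    rw [integral_sub hSint (integrable_finsetSum _ fun a _ => hAint a),
      integral_sub hSint (hcint fun a => ∑ i ∈ a, M i), integral_choice G fun a => ∑ i ∈ a, M i,
      integral_finsetSum _ fun a _ => hAint a]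
    congr 1
    refine Finset.sum_congr rfl fun a _ => ?_
    rw [integral_const_mul, integral_finsetSum _ fun i _ => hint i]
    simp_rw [hmean]
  have hEint : Integrable (fun θ => (K : ℝ) * ∑ i, e i θ) ν :=
    (integrable_finsetSum _ fun i _ => heint i).const_mul _
  rw [hHmean]
  calc ∫ θ, (∑ i ∈ G.choice θ, θ i - ∑ i ∈ G.choice θ, M i) ∂ν
      ≤ ∫ θ, (K * ∑ i, e i θ + β * ∑ i ∈ G.choice θ, S i) ∂ν := by
        refine integral_mono (hSint.sub (hcint fun a => ∑ i ∈ a, M i))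
          (hEint.add (hcint fun a => β * ∑ i ∈ a, S i)) fun θ => ?_
        beta_reduce
        rw [← Finset.sum_sub_distrib]
        have h1 : ∑ i ∈ G.choice θ, e i θ ≤ K * ∑ i, e i θ := by
          calc ∑ i ∈ G.choice θ, e i θ ≤ ∑ _i ∈ G.choice θ, ∑ j, e j θ :=
                Finset.sum_le_sum fun i _ =>
                  Finset.single_le_sum (fun j _ => he0 j θ) (Finset.mem_univ i)
            _ = (G.choice θ).card * ∑ j, e j θ := by rw [Finset.sum_const, nsmul_eq_mul]
            _ ≤ _ := by
              have := Finset.sum_nonneg fun j (_ : j ∈ Finset.univ) => he0 j θ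
              have hc := hK _ (G.mem θ)
              gcongr
        calc ∑ i ∈ G.choice θ, (θ i - M i) ≤ ∑ i ∈ G.choice θ, (e i θ + β * S i) :=
              Finset.sum_le_sum fun i _ => hexc i θ
          _ = ∑ i ∈ G.choice θ, e i θ + β * ∑ i ∈ G.choice θ, S i := by
              rw [Finset.sum_add_distrib, Finset.mul_sum]
          _ ≤ _ := by gcongr
    _ = K * ∑ i, ∫ θ, e i θ ∂ν +
          ∑ a ∈ 𝒜, ν.real {θ' | G.choice θ' = a} * (β * ∑ i ∈ a, S i) := by
        rw [integral_add hEint (hcint fun a => β * ∑ i ∈ a, S i), integral_const_mul,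
          integral_finsetSum _ fun i _ => heint i, integral_choice G fun a => β * ∑ i ∈ a, S i]
    _ ≤ _ := by
        gcongr
        refine (Finset.sum_le_card_nsmul _ _ _ fun i _ => hemean i).trans_eq ?_
        simp

end Round

/-! ### The largest eigenvalue of the prior covariance matrix -/

section Spectrum

variable {N d : ℕ}

lemma maxEigenvalue_nonneg {S : Matrix (Fin d) (Fin d) ℝ} (hS : S.PosSemidef) :
    0 ≤ maxEigenvalue S := by
  refine Real.sSup_nonneg fun r hr => ?_
  rw [hS.1.spectrum_real_eq_range_eigenvalues] at hr
  obtain ⟨k, rfl⟩ := hr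
  exact hS.eigenvalues_nonneg k

open scoped MatrixOrder in
lemma dotProduct_mulVec_le_maxEigenvalue {S : Matrix (Fin d) (Fin d) ℝ} (hS : S.PosSemidef)
    (c : Fin d → ℝ) : c ⬝ᵥ S *ᵥ c ≤ maxEigenvalue S * (c ⬝ᵥ c) := by
  have hb : BddAbove (spectrum ℝ S) := by
    rw [hS.1.spectrum_real_eq_range_eigenvalues]
    exact (Set.finite_range _).bddAbove
  have h : S ≤ algebraMap ℝ _ (maxEigenvalue S) :=
    le_algebraMap_of_spectrum_le (fun r hr => le_csSup hb hr) hS.1.isSelfAdjoint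
  have h2 := (Matrix.le_iff.1 h).dotProduct_mulVec_nonneg c
  rw [star_trivial, sub_mulVec, dotProduct_sub, Algebra.algebraMap_eq_smul_one, smul_mulVec, one_mulVec,
    dotProduct_smul, smul_eq_mul] at h2
  linarith

variable (P : Params d) (x : Fin N → Feature d)

open scoped MatrixOrder in
lemma sqrt_mulVec_dotProduct (c c' : Fin d → ℝ) :
    (CFC.sqrt P.S *ᵥ c) ⬝ᵥ c' = c ⬝ᵥ CFC.sqrt P.S *ᵥ c' := by
  have h : (CFC.sqrt P.S)ᵀ = CFC.sqrt P.S := by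
    rw [← conjTranspose_eq_transpose_of_trivial]
    exact sqrt_isHermitian P
  rw [dotProduct_mulVec, ← mulVec_transpose, h]

open scoped MatrixOrder in
lemma sqrt_mulVec_dotProduct_self_le (c : Fin d → ℝ) :
    (CFC.sqrt P.S *ᵥ c) ⬝ᵥ (CFC.sqrt P.S *ᵥ c) ≤ maxEigenvalue P.S * (c ⬝ᵥ c) := by
  rw [sqrt_mulVec_dotProduct, mulVec_mulVec, CFC.sqrt_mul_sqrt_self P.S P.posSemidef.nonneg]
  exact dotProduct_mulVec_le_maxEigenvalue P.posSemidef c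

variable {x}

lemma feature_dotProduct_self_le {j : Fin N} (hx : ‖x j‖ ≤ 1) :
    (x j).ofLp ⬝ᵥ (x j).ofLp ≤ 1 := by
  have h : ‖x j‖ ^ 2 = (x j).ofLp ⬝ᵥ (x j).ofLp := by
    rw [EuclideanSpace.real_norm_sq_eq]
    simp [dotProduct, sq]
  rw [← h]
  exact pow_le_one₀ (norm_nonneg _) hx

lemma loading_dotProduct_self_le {j : Fin N} (hx : ‖x j‖ ≤ 1) :
    loading P x j ⬝ᵥ loading P x j ≤ maxEigenvalue P.S :=
  (sqrt_mulVec_dotProduct_self_le P _).trans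
    (mul_le_of_le_one_right (maxEigenvalue_nonneg P.posSemidef) (feature_dotProduct_self_le hx))

open scoped MatrixOrder in
lemma loading_dotProduct_sq_le {j : Fin N} (hx : ‖x j‖ ≤ 1) (c : Fin d → ℝ) :
    (loading P x j ⬝ᵥ c) ^ 2 ≤ maxEigenvalue P.S * (c ⬝ᵥ c) := by
  rw [loading, sqrt_mulVec_dotProduct]
  set u := CFC.sqrt P.S *ᵥ c
  have hu : 0 ≤ u ⬝ᵥ u := by simpa using dotProduct_star_self_nonneg u
  have h1 : ((x j).ofLp ⬝ᵥ u) ^ 2 ≤ ((x j).ofLp ⬝ᵥ (x j).ofLp) * (u ⬝ᵥ u) := by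
    simpa [dotProduct, sq] using Finset.sum_mul_sq_le_sq_mul_sq Finset.univ (x j).ofLp u
  exact h1.trans ((mul_le_of_le_one_left hu (feature_dotProduct_self_le hx)).trans
    (sqrt_mulVec_dotProduct_self_le P c))

end Spectrum

/-! ### Summation over the rounds -/

section Paths

variable {N d : ℕ}

/-- A finite sequence of actions, continued by empty sets. -/
def extend {t : ℕ} (α : Fin t → Finset (Fin N)) (k : ℕ) : Finset (Fin N) :=
  if hk : k < t then α ⟨k, hk⟩ else ∅

/-- The sequence of actions of a history, continued by empty sets. -/
def acts {t : ℕ} (h : Hist N t) : ℕ → Finset (Fin N) := extend fun l => (h l).1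

lemma acts_snoc_of_lt {t : ℕ} (h : Hist N t) (r : Record N) {k : ℕ} (hk : k < t) :
    acts (Fin.snoc h r : Hist N (t + 1)) k = acts h k := by
  simp only [acts, extend, hk, Nat.lt_succ_of_lt hk, dite_true]
  rw [show (⟨k, Nat.lt_succ_of_lt hk⟩ : Fin (t + 1)) = Fin.castSucc ⟨k, hk⟩ from rfl,
    Fin.snoc_castSucc]

lemma acts_snoc_self {t : ℕ} (h : Hist N t) (r : Record N) :
    acts (Fin.snoc h r : Hist N (t + 1)) t = r.1 := by
  simp only [acts, extend, Nat.lt_succ_self, dite_true]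
  rw [show (⟨t, Nat.lt_succ_self t⟩ : Fin (t + 1)) = Fin.last t from rfl, Fin.snoc_last]

lemma cnt_congr {A A' : ℕ → Finset (Fin N)} {k : ℕ} (h : ∀ l < k, A l = A' l) :
    cnt A k = cnt A' k := by
  ext i
  exact Finset.sum_congr rfl fun l hl => by rw [h l (Finset.mem_range.1 hl)]

lemma cnt_acts {t : ℕ} (h : Hist N t) : cnt (acts h) t = obsCount h := by
  ext i
  rw [cnt, obsCount, Finset.sum_range]
  simp [acts, extend]

/-- The sum over the rounds of a function of the numbers of observations and the action. -/
def pathSum (w : (Fin N → ℕ) → Finset (Fin N) → ℝ≥0∞) {t : ℕ} (h : Hist N t) : ℝ≥0∞ :=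
  ∑ k ∈ Finset.range t, w (cnt (acts h) k) (acts h k)

lemma pathSum_snoc (w : (Fin N → ℕ) → Finset (Fin N) → ℝ≥0∞) {t : ℕ} (h : Hist N t)
    (r : Record N) :
    pathSum w (Fin.snoc h r : Hist N (t + 1)) = pathSum w h + w (obsCount h) r.1 := by
  have hc : ∀ k ≤ t, cnt (acts (Fin.snoc h r : Hist N (t + 1))) k = cnt (acts h) k := fun k hk =>
    cnt_congr fun l hl => acts_snoc_of_lt h r (hl.trans_le hk)
  rw [pathSum, Finset.sum_range_succ, acts_snoc_self, hc t le_rfl, cnt_acts]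
  congr 1
  refine Finset.sum_congr rfl fun k hk => ?_
  rw [Finset.mem_range] at hk
  rw [hc k hk.le, acts_snoc_of_lt h r hk]

lemma measurable_pathSum (w : (Fin N → ℕ) → Finset (Fin N) → ℝ≥0∞) (t : ℕ) :
    Measurable fun h : Hist N t => pathSum w h :=
  measurable_of_actions fun α => ∑ k ∈ Finset.range t, w (cnt (extend α) k) (extend α k)

variable {P : Params d} {𝒜 : Finset (Finset (Fin N))} (G : GreedyRule P 𝒜)
  (x : Fin N → Feature d)

lemma lintegral_pathSum (θ : Fin N → ℝ) (w : (Fin N → ℕ) → Finset (Fin N) → ℝ≥0∞) (T : ℕ) :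
    ∫⁻ h, pathSum w h ∂(histLaw P G x θ T) = ∑ t ∈ Finset.range T,
      ∫⁻ h, ∑ a ∈ 𝒜, actionProb P G x h a * w (obsCount h) a ∂(histLaw P G x θ t) := by
  induction T with
  | zero => simp [pathSum]
  | succ T ih =>
    rw [lintegral_histLaw_succ G x θ T (measurable_pathSum w (T + 1)), Finset.sum_range_succ, ← ih,
      ← lintegral_add_left (measurable_pathSum w T)]
    refine lintegral_congr fun h => ?_
    simp_rw [pathSum_snoc, lintegral_const, measure_univ, mul_one, mul_add,
      Finset.sum_add_distrib, ← Finset.sum_mul, sum_actionProb, one_mul]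

end Paths

/-! ### The bound on the Bayes regret -/

section Regret

variable {N d : ℕ} {P : Params d} {𝒜 : Finset (Finset (Fin N))} (G : GreedyRule P 𝒜)
  {x : Fin N → Feature d}

/-- The posterior standard deviations of the items in `a` after `n j` observations of each item `j`,
summed over the items. Sets with more than `K` items do not count. -/
def width (P : Params d) (x : Fin N → Feature d) (K : ℕ) (n : Fin N → ℕ) (a : Finset (Fin N)) :
    ℝ :=
  ∑ i ∈ (if a.card ≤ K then a else ∅),
    √(postVar ((P.σ₁ : ℝ) ^ 2) ((P.σ₂ : ℝ) ^ 2) (loading P x) n i)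

lemma width_nonneg (K : ℕ) (n : Fin N → ℕ) (a : Finset (Fin N)) : 0 ≤ width P x K n a :=
  Finset.sum_nonneg fun _ _ => Real.sqrt_nonneg _

/-- The expected regret of a round given the history. -/
lemma lintegral_likelihood_mul_regret_le (h𝒜 : 𝒜.Nonempty) {K : ℕ} (hK : ∀ a ∈ 𝒜, a.card ≤ K)
    (hx : ∀ i, ‖x i‖ ≤ 1) {β : ℝ} (hβ : 0 < β) {t : ℕ} (h : Hist N t) :
    ∫⁻ θ, likelihood P h θ *
        ∑ a ∈ 𝒜, actionProb P G x h a * ENNReal.ofReal (gap P 𝒜 h𝒜 θ a) ∂(prior P x) ≤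
      ∫⁻ θ, likelihood P h θ * (ENNReal.ofReal (K * (N * (√(maxEigenvalue P.S + (P.σ₁ : ℝ) ^ 2) /
        β * Real.exp (-β ^ 2 / 2)))) + ∑ a ∈ 𝒜, actionProb P G x h a *
          ENNReal.ofReal (β * width P x K (obsCount h) a)) ∂(prior P x) := by
  have h₁ : (0 : ℝ) < (P.σ₁ : ℝ) ^ 2 := pow_pos P.σ₁_pos 2
  have h₂ : (0 : ℝ) < (P.σ₂ : ℝ) ^ 2 := pow_pos P.σ₂_pos 2
  choose M hM using exists_posterior_map_eq P x h
  rw [lintegral_likelihood_mul P x h (Finset.measurable_sum _ fun a _ =>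
      (measurable_gap G h𝒜 a).ennreal_ofReal.const_mul _),
    lintegral_mul_const _ (measurable_likelihood_right P h)]
  refine mul_le_mul_right ?_ _
  simp_rw [actionProb_eq]
  refine (lintegral_regret_round_le G h𝒜 hK (fun i => postVar_pos h₁ h₂ _ _ i) hM
    (V₀ := maxEigenvalue P.S + (P.σ₁ : ℝ) ^ 2) (fun i => ?_) hβ).trans_eq ?_
  · exact (postVar_le h₁ h₂ _ _ i).trans (by
      have := loading_dotProduct_self_le P (hx i)
      linarith)
  · congr 1
    refine Finset.sum_congr rfl fun a ha => ?_
    simp only [width, hK a ha, if_true]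

/-- The sum of the posterior standard deviations of the chosen items along a history. -/
lemma pathSum_width_le (hx : ∀ i, ‖x i‖ ≤ 1) (K : ℕ) {T : ℕ} (hT : 0 < T) {β : ℝ} (hβ : 0 ≤ β)
    (h : Hist N T) : pathSum (fun n a => ENNReal.ofReal (β * width P x K n a)) h ≤
      ENNReal.ofReal (β * (√((maxEigenvalue P.S + (P.σ₁ : ℝ) ^ 2) /
          Real.log (1 + (maxEigenvalue P.S + (P.σ₁ : ℝ) ^ 2) / (P.σ₂ : ℝ) ^ 2)) *
        (K * √((T : ℝ) * d) * √(Real.log (1 + N * maxEigenvalue P.S /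
            ((P.σ₁ : ℝ) ^ 2 + (P.σ₂ : ℝ) ^ 2 / T))) +
          √((N : ℝ) * T * K) * √(Real.log (1 + (P.σ₁ : ℝ) ^ 2 / (P.σ₂ : ℝ) ^ 2 * T))))) := by
  have h₁ : (0 : ℝ) < (P.σ₁ : ℝ) ^ 2 := pow_pos P.σ₁_pos 2
  have h₂ : (0 : ℝ) < (P.σ₂ : ℝ) ^ 2 := pow_pos P.σ₂_pos 2
  rw [pathSum, ← ENNReal.ofReal_sum_of_nonneg fun k _ => mul_nonneg hβ (width_nonneg _ _ _),
    ← Finset.mul_sum]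
  refine ENNReal.ofReal_le_ofReal (mul_le_mul_of_nonneg_left ?_ hβ)
  have := sum_sqrt_postVar_le h₁ h₂ (v := loading P x) (maxEigenvalue_nonneg P.posSemidef)
    (fun j => loading_dotProduct_sq_le P (hx j)) (fun j => loading_dotProduct_self_le P (hx j))
    (A := acts h) (B := fun k => if (acts h k).card ≤ K then acts h k else ∅) (K := K)
    (fun k => by split_ifs <;> simp) (fun k => by split_ifs with hk <;> simp [hk]) hT
  simpa only [Fintype.card_fin, width] using this

lemma lintegral_regret_le (h𝒜 : 𝒜.Nonempty) {K : ℕ} (hK : ∀ a ∈ 𝒜, a.card ≤ K)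
    (hx : ∀ i, ‖x i‖ ≤ 1) {β : ℝ} (hβ : 0 < β) {T : ℕ} (hT : 0 < T) :
    ∫⁻ γ, ∫⁻ θ, regret P G h𝒜 x T θ ∂(itemPrior P x γ) ∂(metaPrior P) ≤
      ENNReal.ofReal (T * (K * (N * (√(maxEigenvalue P.S + (P.σ₁ : ℝ) ^ 2) /
          β * Real.exp (-β ^ 2 / 2)))) +
        β * (√((maxEigenvalue P.S + (P.σ₁ : ℝ) ^ 2) /
          Real.log (1 + (maxEigenvalue P.S + (P.σ₁ : ℝ) ^ 2) / (P.σ₂ : ℝ) ^ 2)) *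
        (K * √((T : ℝ) * d) * √(Real.log (1 + N * maxEigenvalue P.S /
            ((P.σ₁ : ℝ) ^ 2 + (P.σ₂ : ℝ) ^ 2 / T))) +
          √((N : ℝ) * T * K) * √(Real.log (1 + (P.σ₁ : ℝ) ^ 2 / (P.σ₂ : ℝ) ^ 2 * T))))) := by
  set c₀ := K * (N * (√(maxEigenvalue P.S + (P.σ₁ : ℝ) ^ 2) / β * Real.exp (-β ^ 2 / 2)))
  have hc₀ : 0 ≤ c₀ := by positivity
  set D := √((maxEigenvalue P.S + (P.σ₁ : ℝ) ^ 2) /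
          Real.log (1 + (maxEigenvalue P.S + (P.σ₁ : ℝ) ^ 2) / (P.σ₂ : ℝ) ^ 2)) *
        (K * √((T : ℝ) * d) * √(Real.log (1 + N * maxEigenvalue P.S /
            ((P.σ₁ : ℝ) ^ 2 + (P.σ₂ : ℝ) ^ 2 / T))) +
          √((N : ℝ) * T * K) * √(Real.log (1 + (P.σ₁ : ℝ) ^ 2 / (P.σ₂ : ℝ) ^ 2 * T)))
  have hD : 0 ≤ D := by positivity
  let w : (Fin N → ℕ) → Finset (Fin N) → ℝ≥0∞ := fun n a => ENNReal.ofReal (β * width P x K n a)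
  have hw : ∀ t, Measurable fun h : Hist N t =>
      ∑ a ∈ 𝒜, actionProb P G x h a * w (obsCount h) a := fun t =>
    Finset.measurable_sum _ fun a _ => (measurable_actionProb x G t a).mul
      (measurable_of_actions fun α : Fin t → Finset (Fin N) =>
        w (fun i => ∑ l, if i ∈ α l then 1 else 0) a)
  have hg : ∀ t, Measurable fun p : Hist N t × (Fin N → ℝ) =>
      ∑ a ∈ 𝒜, actionProb P G x p.1 a * ENNReal.ofReal (gap P 𝒜 h𝒜 p.2 a) := fun t =>
    Finset.measurable_sum _ fun a _ => ((measurable_actionProb x G t a).comp measurable_fst).mul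
      ((measurable_gap G h𝒜 a).comp measurable_snd).ennreal_ofReal
  have hround : ∀ t, ∫⁻ θ, ∫⁻ h, ∑ a ∈ 𝒜, actionProb P G x h a *
        ENNReal.ofReal (gap P 𝒜 h𝒜 θ a) ∂(histLaw P G x θ t) ∂(prior P x) ≤
      ∫⁻ θ, ∫⁻ h, (ENNReal.ofReal c₀ + ∑ a ∈ 𝒜, actionProb P G x h a * w (obsCount h) a)
        ∂(histLaw P G x θ t) ∂(prior P x) := fun t => by
    rw [lintegral_prior_histLaw G x t (hg t), lintegral_prior_histLaw G x t
      (F := fun p => ENNReal.ofReal c₀ + ∑ a ∈ 𝒜, actionProb P G x p.1 a * w (obsCount p.1) a)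
      (((hw t).comp measurable_fst).const_add _)]
    exact pathIntegral_mono G x t fun h => lintegral_likelihood_mul_regret_le G h𝒜 hK hx hβ h
  have hmeas : ∀ t, Measurable fun θ => ∫⁻ h, ∑ a ∈ 𝒜, actionProb P G x h a *
      ENNReal.ofReal (gap P 𝒜 h𝒜 θ a) ∂(histLaw P G x θ t) := fun t =>
    measurable_lintegral_histLaw G x t (hg t)
  have hmeas' : ∀ t, Measurable fun θ => ∫⁻ h, (ENNReal.ofReal c₀ +
      ∑ a ∈ 𝒜, actionProb P G x h a * w (obsCount h) a) ∂(histLaw P G x θ t) := fun t =>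
    measurable_lintegral_histLaw G x t
      (F := fun p => ENNReal.ofReal c₀ + ∑ a ∈ 𝒜, actionProb P G x p.1 a * w (obsCount p.1) a)
      (((hw t).comp measurable_fst).const_add _)
  have hregret : Measurable (regret P G h𝒜 x T) := by
    unfold regret
    exact Finset.measurable_sum _ fun t _ => hmeas t
  rw [lintegral_prior P x hregret]
  calc ∫⁻ θ, regret P G h𝒜 x T θ ∂(prior P x)
      = ∑ t ∈ Finset.range T, ∫⁻ θ, ∫⁻ h, ∑ a ∈ 𝒜, actionProb P G x h a *
          ENNReal.ofReal (gap P 𝒜 h𝒜 θ a) ∂(histLaw P G x θ t) ∂(prior P x) :=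
        lintegral_finsetSum _ fun t _ => hmeas t
    _ ≤ ∑ t ∈ Finset.range T, ∫⁻ θ, ∫⁻ h, (ENNReal.ofReal c₀ +
          ∑ a ∈ 𝒜, actionProb P G x h a * w (obsCount h) a) ∂(histLaw P G x θ t) ∂(prior P x) :=
        Finset.sum_le_sum fun t _ => hround t
    _ = ∫⁻ θ, ∑ t ∈ Finset.range T, ∫⁻ h, (ENNReal.ofReal c₀ +
          ∑ a ∈ 𝒜, actionProb P G x h a * w (obsCount h) a) ∂(histLaw P G x θ t) ∂(prior P x) :=
        (lintegral_finsetSum _ fun t _ => hmeas' t).symm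
    _ ≤ ∫⁻ _θ, (T * ENNReal.ofReal c₀ + ENNReal.ofReal (β * D)) ∂(prior P x) := by
        refine lintegral_mono fun θ => ?_
        have hp := isProbabilityMeasure_histLaw G x θ
        have hsplit : ∀ t, ∫⁻ h, (ENNReal.ofReal c₀ + ∑ a ∈ 𝒜, actionProb P G x h a *
            w (obsCount h) a) ∂(histLaw P G x θ t) = ENNReal.ofReal c₀ +
            ∫⁻ h, ∑ a ∈ 𝒜, actionProb P G x h a * w (obsCount h) a ∂(histLaw P G x θ t) :=
          fun t => by
            rw [lintegral_add_left measurable_const, lintegral_const, (hp t).measure_univ, mul_one]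
        simp_rw [hsplit]
        rw [Finset.sum_add_distrib, Finset.sum_const, Finset.card_range, nsmul_eq_mul,
          ← lintegral_pathSum G x θ w T]
        gcongr
        calc ∫⁻ h, pathSum w h ∂(histLaw P G x θ T)
            ≤ ∫⁻ _h, ENNReal.ofReal (β * D) ∂(histLaw P G x θ T) :=
              lintegral_mono fun h => pathSum_width_le hx K hT hβ.le h
          _ = _ := by rw [lintegral_const, (hp T).measure_univ, mul_one]
    _ = _ := by
        rw [lintegral_const, measure_univ, mul_one, ENNReal.ofReal_add (by positivity)
          (by positivity), ENNReal.ofReal_mul (p := (T : ℝ)) (by positivity),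
          ENNReal.ofReal_natCast]

/-- The confidence parameter for which the coefficient of the sum of the posterior standard
deviations is the factor `c₁` of the bound. -/
def confidence (N T : ℕ) : ℝ := √(8 * Real.log (4 * N * (T : ℝ) ^ 2))

lemma one_le_log_four_mul {N T : ℕ} (hN : 0 < N) (hT : 0 < T) :
    1 ≤ Real.log (4 * N * (T : ℝ) ^ 2) := by
  have hN' : (1 : ℝ) ≤ N := by exact_mod_cast hN
  have hT' : (1 : ℝ) ≤ T := by exact_mod_cast hT
  have h4 : (4 : ℝ) ≤ 4 * N * (T : ℝ) ^ 2 := by nlinarith [mul_le_mul hN' (one_le_pow₀ hT' (n := 2))]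
  rw [Real.le_log_iff_exp_le (by linarith)]
  linarith [Real.exp_one_lt_d9]

lemma confidence_mul_sqrt (P : Params d) {N T : ℕ} (hN : 0 < N) (hT : 0 < T) :
    confidence N T * √((maxEigenvalue P.S + (P.σ₁ : ℝ) ^ 2) /
      Real.log (1 + (maxEigenvalue P.S + (P.σ₁ : ℝ) ^ 2) / (P.σ₂ : ℝ) ^ 2)) = c₁ P N T := by
  have hl := one_le_log_four_mul hN hT
  rw [confidence, ← Real.sqrt_mul (by positivity), c₁, show (4 : ℝ) = √(4 ^ 2) by simp,
    ← Real.sqrt_mul (by positivity)]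
  congr 1
  simp only [Real.sqrt_sq (show (0 : ℝ) ≤ 4 by norm_num)]
  generalize maxEigenvalue P.S + (P.σ₁ : ℝ) ^ 2 = V
  generalize Real.log (1 + V / (P.σ₂ : ℝ) ^ 2) = L
  rw [← div_div]
  ring

/-- The probability that the confidence bounds fail contributes less than the last term of the
bound. -/
lemma confidence_tail_le {N T : ℕ} (hN : 0 < N) (hT : 0 < T) {V : ℝ} :
    T * (N * (√V / confidence N T * Real.exp (-confidence N T ^ 2 / 2))) ≤ √(2 / N * V) := by
  have hN' : (1 : ℝ) ≤ N := by exact_mod_cast hN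
  have hT' : (1 : ℝ) ≤ T := by exact_mod_cast hT
  have hl := one_le_log_four_mul hN hT
  set X := 4 * N * (T : ℝ) ^ 2 with hX
  have hX0 : 0 < X := by positivity
  have hβ : 1 ≤ confidence N T := Real.one_le_sqrt.2 (by linarith)
  have hexp : Real.exp (-confidence N T ^ 2 / 2) ≤ X⁻¹ ^ 2 := by
    rw [confidence, Real.sq_sqrt (by linarith), ← hX, ← Real.exp_log (inv_pos.2 hX0),
      ← Real.exp_nat_mul, Real.log_inv]
    refine Real.exp_le_exp.2 ?_
    push_cast
    linarith
  have hVdiv : √V / confidence N T ≤ √V := div_le_self (Real.sqrt_nonneg _) hβ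
  have hTX : T * N ≤ X := by
    have : (T : ℝ) * N * 1 ≤ T * N * (4 * T) := by gcongr; linarith
    rw [hX]; linarith
  have hNX : X⁻¹ ≤ (N : ℝ)⁻¹ := by
    have : (N : ℝ) * 1 ≤ N * (4 * (T : ℝ) ^ 2) := by
      gcongr
      nlinarith
    exact inv_anti₀ (by positivity) (by rw [hX]; linarith)
  have hsqrt : (N : ℝ)⁻¹ ≤ √(2 / N) := by
    refine Real.le_sqrt_of_sq_le ?_
    rw [inv_pow, inv_eq_one_div, div_le_div_iff₀ (by positivity) (by positivity)]
    nlinarith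
  calc T * (N * (√V / confidence N T * Real.exp (-confidence N T ^ 2 / 2)))
      ≤ T * (N * (√V * X⁻¹ ^ 2)) := by gcongr
    _ = (T * N * X⁻¹) * X⁻¹ * √V := by ring
    _ ≤ 1 * √(2 / N) * √V := by
        gcongr
        · rw [← div_eq_mul_inv]
          exact (div_le_one hX0).2 hTX
        · exact hNX.trans hsqrt
    _ = √(2 / N * V) := by rw [one_mul, Real.sqrt_mul (by positivity)]

lemma bayesRegret_le (hN : 0 < N) {K T : ℕ} (hT : 0 < T) (h𝒜 : 𝒜.Nonempty)
    (hK : ∀ a ∈ 𝒜, a.card ≤ K) (ρ : Measure (Fin N → Feature d)) [IsProbabilityMeasure ρ]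
    (hρ : ∀ᵐ x ∂ρ, ∀ i, ‖x i‖ ≤ 1) :
    bayesRegret P G h𝒜 ρ T ≤ ENNReal.ofReal (regretBound P N K T) := by
  have hβ : 0 < confidence N T := by
    have := one_le_log_four_mul hN hT
    exact Real.sqrt_pos.2 (by linarith)
  calc bayesRegret P G h𝒜 ρ T ≤ ∫⁻ _x, ENNReal.ofReal (regretBound P N K T) ∂ρ := by
        refine lintegral_mono_ae (hρ.mono fun x hx => ?_)
        refine (lintegral_regret_le G h𝒜 hK hx hβ hT).trans (ENNReal.ofReal_le_ofReal ?_)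
        rw [← mul_assoc (confidence N T), confidence_mul_sqrt P hN hT, regretBound]
        have h := mul_le_mul_of_nonneg_left (confidence_tail_le hN hT
          (V := maxEigenvalue P.S + (P.σ₁ : ℝ) ^ 2)) (Nat.cast_nonneg (α := ℝ) K)
        linarith
    _ = _ := by rw [lintegral_const, measure_univ, mul_one]

end Regret

/-! ### The order of the bound -/

section Order

/-- The quotient `V / log (1 + V / s)` stays bounded when `s` tends to zero or to infinity, and
compensates the growth of the logarithm of the signal-to-noise ratio. -/
lemma div_log_mul_log_le {V s m X : ℝ} (hV : 0 < V) (hs : 0 < s) (hm : 1 ≤ m) (hX : 0 < X)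
    (hXm : X ≤ 1 + m * (V / s)) :
    V / Real.log (1 + V / s) * Real.log X ≤ (V + s) * (1 + Real.log m) := by
  have hy : 0 < V / s := by positivity
  have hL : 0 < Real.log (1 + V / s) := Real.log_pos (by linarith)
  have hlm : 0 ≤ Real.log m := Real.log_nonneg hm
  have h1 : Real.log X ≤ Real.log m + Real.log (1 + V / s) := by
    rw [← Real.log_mul (by positivity) (by positivity)]
    exact Real.log_le_log hX (by linarith)
  have h2 : V / Real.log (1 + V / s) ≤ V + s := by
    have h3 := Real.one_sub_inv_le_log_of_pos (show 0 < 1 + V / s by positivity)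
    have h4 : 1 - (1 + V / s)⁻¹ = V / (V + s) := by
      field_simp
      ring
    rw [h4, div_le_iff₀ (by positivity)] at h3
    rw [div_le_iff₀ hL]
    linarith
  calc V / Real.log (1 + V / s) * Real.log X
      ≤ V / Real.log (1 + V / s) * (Real.log m + Real.log (1 + V / s)) := by gcongr
    _ = V / Real.log (1 + V / s) * Real.log m + V := by
        generalize Real.log (1 + V / s) = L at hL
        field_simp
    _ ≤ (V + s) * Real.log m + (V + s) := by gcongr; linarith
    _ = _ := by ring

variable {d : ℕ}

lemma c₁_mul_sqrt_log_le (P : Params d) {N T : ℕ} (hN : 0 < N) (hT : 0 < T) {X : ℝ} (hX : 1 ≤ X)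
    (hXm : X ≤ 1 + N * T * ((maxEigenvalue P.S + (P.σ₁ : ℝ) ^ 2) / (P.σ₂ : ℝ) ^ 2)) :
    c₁ P N T * √(Real.log X) ≤
      4 * √(maxEigenvalue P.S + (P.σ₁ : ℝ) ^ 2 + (P.σ₂ : ℝ) ^ 2) *
        (1 + Real.log ((N : ℝ) * T)) := by
  have h₁ : (0 : ℝ) < (P.σ₁ : ℝ) ^ 2 := pow_pos P.σ₁_pos 2
  have h₂ : (0 : ℝ) < (P.σ₂ : ℝ) ^ 2 := pow_pos P.σ₂_pos 2
  have hlam := maxEigenvalue_nonneg P.posSemidef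
  have hN' : (1 : ℝ) ≤ N := by exact_mod_cast hN
  have hT' : (1 : ℝ) ≤ T := by exact_mod_cast hT
  have hm : (1 : ℝ) ≤ N * T := one_le_mul_of_one_le_of_one_le hN' hT'
  have hl := one_le_log_four_mul hN hT
  rw [c₁]
  set V := maxEigenvalue P.S + (P.σ₁ : ℝ) ^ 2
  set s := (P.σ₂ : ℝ) ^ 2
  set ℓ := Real.log ((N : ℝ) * T)
  have hV : 0 < V := by positivity
  have hℓ : 0 ≤ ℓ := Real.log_nonneg hm
  have hlog : Real.log (4 * N * (T : ℝ) ^ 2) ≤ 2 * (1 + ℓ) := by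
    have h4 : Real.log 4 ≤ 2 := by
      rw [show (4 : ℝ) = 2 ^ 2 by norm_num, Real.log_pow]
      have := Real.log_two_lt_d9
      push_cast
      linarith
    calc Real.log (4 * N * (T : ℝ) ^ 2) ≤ Real.log (4 * ((N : ℝ) * T) ^ 2) := by
          refine Real.log_le_log (by positivity) ?_
          rw [mul_pow, ← mul_assoc]
          gcongr
          exact le_self_pow₀ hN' two_ne_zero
      _ = Real.log 4 + 2 * ℓ := by
          rw [Real.log_mul (by norm_num) (by positivity), Real.log_pow]
          rfl
      _ ≤ _ := by linarith
  have hlogX : 0 ≤ Real.log X := Real.log_nonneg hX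
  have hL : 0 < Real.log (1 + V / s) := by
    refine Real.log_pos ?_
    have : 0 < V / s := by positivity
    linarith
  have hmain := div_log_mul_log_le hV h₂ hm (by linarith) hXm
  have hprod : V / (2 * Real.log (1 + V / s)) * Real.log (4 * N * (T : ℝ) ^ 2) * Real.log X ≤
      (V + s) * (1 + ℓ) ^ 2 := by
    calc V / (2 * Real.log (1 + V / s)) * Real.log (4 * N * (T : ℝ) ^ 2) * Real.log X
        = V / Real.log (1 + V / s) * Real.log X * (Real.log (4 * N * (T : ℝ) ^ 2) / 2) := by
          generalize Real.log (1 + V / s) = L at hL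
          field_simp
      _ ≤ (V + s) * (1 + ℓ) * (1 + ℓ) := by
          gcongr
          linarith
      _ = _ := by ring
  calc 4 * √(V / (2 * Real.log (1 + V / s)) * Real.log (4 * N * (T : ℝ) ^ 2)) * √(Real.log X)
      = 4 * √(V / (2 * Real.log (1 + V / s)) * Real.log (4 * N * (T : ℝ) ^ 2) * Real.log X) := by
        rw [mul_assoc, ← Real.sqrt_mul (by positivity)]
    _ ≤ 4 * √((V + s) * (1 + ℓ) ^ 2) := by gcongr
    _ = 4 * √(V + s) * (1 + ℓ) := by
        rw [Real.sqrt_mul (by positivity), Real.sqrt_sq (by positivity), mul_assoc]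

lemma regretBound_le (P : Params d) {N K T : ℕ} (hN : 0 < N) (hd : 0 < d) (hT : 0 < T) {M : ℝ}
    (hlamM : maxEigenvalue P.S ≤ M) (h₁M : (P.σ₁ : ℝ) ≤ M) (h₂M : (P.σ₂ : ℝ) ≤ M) :
    regretBound P N K T ≤ (4 * √(M + M ^ 2 + M ^ 2) + √(2 * (M + M ^ 2 + M ^ 2))) *
      (1 + Real.log ((N : ℝ) * T)) * (K * √((T : ℝ) * d) + √((N : ℝ) * T * K)) := by
  have h₁ : (0 : ℝ) < (P.σ₁ : ℝ) ^ 2 := pow_pos P.σ₁_pos 2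
  have h₂ : (0 : ℝ) < (P.σ₂ : ℝ) ^ 2 := pow_pos P.σ₂_pos 2
  have hlam := maxEigenvalue_nonneg P.posSemidef
  have hN' : (1 : ℝ) ≤ N := by exact_mod_cast hN
  have hT' : (1 : ℝ) ≤ T := by exact_mod_cast hT
  have hd' : (1 : ℝ) ≤ d := by exact_mod_cast hd
  have hℓ : 0 ≤ Real.log ((N : ℝ) * T) :=
    Real.log_nonneg (one_le_mul_of_one_le_of_one_le hN' hT')
  have h₁M' : (P.σ₁ : ℝ) ^ 2 ≤ M ^ 2 := by gcongr
  have h₂M' : (P.σ₂ : ℝ) ^ 2 ≤ M ^ 2 := by gcongr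
  have hX₁ : 1 + N * maxEigenvalue P.S / ((P.σ₁ : ℝ) ^ 2 + (P.σ₂ : ℝ) ^ 2 / T) ≤
      1 + N * T * ((maxEigenvalue P.S + (P.σ₁ : ℝ) ^ 2) / (P.σ₂ : ℝ) ^ 2) := by
    gcongr
    calc N * maxEigenvalue P.S / ((P.σ₁ : ℝ) ^ 2 + (P.σ₂ : ℝ) ^ 2 / T)
        ≤ N * (maxEigenvalue P.S + (P.σ₁ : ℝ) ^ 2) / ((P.σ₂ : ℝ) ^ 2 / T) := by
          gcongr <;> linarith
      _ = _ := by field_simp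
  have hX₂ : 1 + (P.σ₁ : ℝ) ^ 2 / (P.σ₂ : ℝ) ^ 2 * T ≤
      1 + N * T * ((maxEigenvalue P.S + (P.σ₁ : ℝ) ^ 2) / (P.σ₂ : ℝ) ^ 2) := by
    refine add_le_add_right ?_ 1
    calc (P.σ₁ : ℝ) ^ 2 / (P.σ₂ : ℝ) ^ 2 * T
        = 1 * T * ((0 + (P.σ₁ : ℝ) ^ 2) / (P.σ₂ : ℝ) ^ 2) := by ring
      _ ≤ _ := by gcongr
  have hfirst := c₁_mul_sqrt_log_le P hN hT (le_add_of_nonneg_right (by positivity)) hX₁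
  have hsecond := c₁_mul_sqrt_log_le P hN hT (le_add_of_nonneg_right (by positivity)) hX₂
  have hQ : √(maxEigenvalue P.S + (P.σ₁ : ℝ) ^ 2 + (P.σ₂ : ℝ) ^ 2) ≤ √(M + M ^ 2 + M ^ 2) := by
    gcongr
  have hM : 0 ≤ M := hlam.trans hlamM
  set Q := M + M ^ 2 + M ^ 2
  set ℓ := Real.log ((N : ℝ) * T)
  have hthird : √(2 / (N : ℝ) * (maxEigenvalue P.S + (P.σ₁ : ℝ) ^ 2)) ≤
      √(2 * Q) * (1 + ℓ) * √((T : ℝ) * d) := by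
    have hTd : 1 ≤ √((T : ℝ) * d) :=
      Real.one_le_sqrt.2 (one_le_mul_of_one_le_of_one_le hT' hd')
    have h2N : 2 / (N : ℝ) ≤ 2 := div_le_self zero_le_two hN'
    have hQ' : maxEigenvalue P.S + (P.σ₁ : ℝ) ^ 2 ≤ Q := by
      have := sq_nonneg M
      simp only [Q]
      linarith
    calc √(2 / (N : ℝ) * (maxEigenvalue P.S + (P.σ₁ : ℝ) ^ 2)) ≤ √(2 * Q) * 1 * 1 := by
          rw [mul_one, mul_one]
          gcongr
      _ ≤ _ := by
          gcongr
          linarith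
  calc regretBound P N K T
      = c₁ P N T * √(Real.log (1 + N * maxEigenvalue P.S / ((P.σ₁ : ℝ) ^ 2 + (P.σ₂ : ℝ) ^ 2 / T))) *
            (K * √((T : ℝ) * d)) +
          c₁ P N T * √(Real.log (1 + (P.σ₁ : ℝ) ^ 2 / (P.σ₂ : ℝ) ^ 2 * T)) *
            √((N : ℝ) * T * K) +
          K * √(2 / (N : ℝ) * (maxEigenvalue P.S + (P.σ₁ : ℝ) ^ 2)) := by
        rw [regretBound]
        ring
    _ ≤ 4 * √Q * (1 + ℓ) * (K * √((T : ℝ) * d)) + 4 * √Q * (1 + ℓ) * √((N : ℝ) * T * K) +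
          K * (√(2 * Q) * (1 + ℓ) * √((T : ℝ) * d)) := by
        refine add_le_add (add_le_add
          (mul_le_mul_of_nonneg_right (hfirst.trans ?_) (by positivity))
          (mul_le_mul_of_nonneg_right (hsecond.trans ?_) (by positivity)))
          (mul_le_mul_of_nonneg_left hthird (by positivity)) <;> gcongr
    _ ≤ 4 * √Q * (1 + ℓ) * (K * √((T : ℝ) * d)) + 4 * √Q * (1 + ℓ) * √((N : ℝ) * T * K) +
          K * (√(2 * Q) * (1 + ℓ) * √((T : ℝ) * d)) +
          √(2 * Q) * (1 + ℓ) * √((N : ℝ) * T * K) := le_add_of_nonneg_right (by positivity)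
    _ = _ := by ring

end Order

end SemiBandit

end

theorem theorem2 :
    -- the bound on the Bayes regret
    (∀ (N d K T : ℕ), 0 < N → 0 < d → 0 < T →
      ∀ (P : SemiBandit.Params d)
        (𝒜 : Finset (Finset (Fin N))) (h𝒜 : 𝒜.Nonempty), (∀ a ∈ 𝒜, a.card ≤ K) →
      ∀ (G : SemiBandit.GreedyRule P 𝒜)
        (ρ : Measure (Fin N → SemiBandit.Feature d)), IsProbabilityMeasure ρ →
        (∀ᵐ x ∂ρ, ∀ i, ‖x i‖ ≤ 1) →
        SemiBandit.bayesRegret P G h𝒜 ρ T ≤ ENNReal.ofReal (SemiBandit.regretBound P N K T)) ∧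
    -- the order of the bound, up to powers of `log (N T)`, while the parameters stay bounded
    (∃ p : ℕ, ∀ M : ℝ, ∃ C : ℝ, ∀ (N d K T : ℕ), 0 < N → 0 < d → 0 < T →
      ∀ P : SemiBandit.Params d,
        SemiBandit.maxEigenvalue P.S ≤ M → (P.σ₁ : ℝ) ≤ M → (P.σ₂ : ℝ) ≤ M →
        SemiBandit.regretBound P N K T ≤
          C * (1 + Real.log ((N : ℝ) * T)) ^ p *
            (K * √((T : ℝ) * d) + √((N : ℝ) * T * K))) := by
  refine ⟨fun N d K T hN _ hT P 𝒜 h𝒜 hK G ρ _ hρ =>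
      SemiBandit.bayesRegret_le G hN hT h𝒜 hK ρ hρ, 1, fun M =>
    ⟨4 * √(M + M ^ 2 + M ^ 2) + √(2 * (M + M ^ 2 + M ^ 2)),
      fun N d K T hN hd hT P hlam h₁ h₂ => ?_⟩⟩
  rw [pow_one]
  exact SemiBandit.regretBound_le P hN hd hT hlam h₁ h₂
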